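/- **Proposition (Best-Case Quantiles of RVaR).** For a distribution function $G$ on $\mathbb R$ with finite second moment let $G^{-1}(u)=\inf\{y: G(y)\ge u\}$ and $G^{-1}(u+)=\inf\{y:G(y)>u\}$, $0<u<1$, and put $G^{-1}(0)=\lim_{u\downarrow 0}G^{-1}(u)$, $G^{-1}(1)=\lim_{u\uparrow 1}G^{-1}(u)$ (possibly infinite). Let $U$ be uniform on $(0,1)$, let $d_W$ be the Wasserstein distance of order 2, and identify a left-continuous non-decreasing function on $(0,1)$ with the distribution of which it is the quantile function. Let $0<\alpha<\beta\le 1$, $\gamma=\frac1{\beta-\alpha}\mathbf 1_{(\alpha,\beta]}$ and $\mathrm{RVaR}_{\alpha,\beta}(G)=\int_0^1\gamma(u)G^{-1}(u)\,du$. Let $F$ have mean $\mu_F$ and standard deviation $\sigma_F>0$, let $\mu\in\mathbb R$, $\sigma>0$, and let $\mathcal M_\varepsilon(\mu,\sigma)$ be the set of $G$ with mean $\mu$, standard deviation $\sigma$ and $d_W(F,G)\le\sqrt\varepsilon$. For $\lambda\ge0$ let $k_\lambda^\downarrow$ be the antitonic projection of $\gamma-\lambda F^{-1}$, that is, its nearest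 point in $L^2(0,1)$ among the square-integrable, non-increasing, left-continuous functions on $(0,1)$. For $\lambda>0$ let $h_\lambda^\downarrow=\mu+\sigma\,(a_\lambda-k_\lambda^\downarrow)/b_\lambda$, where $a_\lambda$ and $b_\lambda$ are the mean and standard deviation of $k_\lambda^\downarrow(U)$. Assume that $\inf\{\lambda\ge0: k_\lambda^\downarrow\text{ is not constant}\}=0$ (with $\inf\emptyset=+\infty$), and that, with $c_0=\lim_{\lambda\downarrow0}\mathrm{corr}(F^{-1}(U),-k_\lambda^\downarrow(U))$, $$(\mu_F-\mu)^2+(\sigma_F-\sigma)^2<\varepsilon<(\mu_F-\mu)^2+(\sigma_F-\sigma)^2+2\sigma\sigma_F(1-c_0).$$ Then there is a unique $\lambda>0$ with $d_W(F^{-1},h_\lambda^\downarrow)=\sqrt\varepsilon$; for this $\lambda$, $\mathrm{RVaR}_{\alpha,\beta}$ has exactly one minimiser over $\mathcal M_\varepsilon(\mu,\sigma)$, its quantile function is $h_\lambda^\downarrow$, and $$k_\lambda^\downarrow(u)=\begin{cases}-\lambda F^{-1}(u), & 0<u\le z_0,\\ -c, & z_0<u\le z_1,\\ -\lambda F^{-1}(u)+\frac1{\beta-\alpha},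 & z_1<u\le\beta,\\ -\lambda F^{-1}(u), & \beta<u<1,\end{cases}$$ where $0\le z_0\le\alpha\le z_1\le\beta$ and $c\in\mathbb R$ satisfy the following conditions (such $z_0,z_1,c$ exist, and any of them give $k_\lambda^\downarrow$): * if $c\le\lambda F^{-1}(0)$, then $z_0=0$; otherwise $z_0>0$ and $\lambda F^{-1}(z_0)\le c\le\lambda F^{-1}(z_0+)$; * if $\frac1{\beta-\alpha}<\lambda F^{-1}(\beta)-c$, then $z_1<\beta$ and $\lambda F^{-1}(z_1)\le c+\frac1{\beta-\alpha}\le\lambda F^{-1}(z_1+)$; otherwise $z_1=\beta$; * if $z_0<z_1$, then $$c=-\frac{z_1-\alpha}{z_1-z_0}\,\frac1{\beta-\alpha}+\frac{\lambda}{z_1-z_0}\int_{z_0}^{z_1}F^{-1}(u)\,du.$$ If $F^{-1}$ is continuous on $(0,1)$, all such $z_0,z_1,c$ satisfy $z_0<z_1$, the last formula for $c$, and $$\lambda F^{-1}(z_0)=\begin{cases}\lambda F^{-1}(0)&\text{if }c\le\lambda F^{-1}(0),\\ c&\text{otherwise,}\end{cases}\qquad \lambda F^{-1}(z_1)=\begin{cases}c+\frac1{\beta-\alpha}&\text{if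 }\frac1{\beta-\alpha}<\lambda F^{-1}(\beta)-c,\\ \lambda F^{-1}(\beta)&\text{otherwise;}\end{cases}$$ in the first case for $z_1$ one also has $\lambda F^{-1}(z_1)=\lambda F^{-1}(z_0)+\frac1{\beta-\alpha}$ whenever $c\ge\lambda F^{-1}(0)$. -/

import Mathlib

open MeasureTheory ProbabilityTheory Set Filter Topology

noncomputable section

namespace BestCaseRVaR

/-! ### Distribution functions, quantile functions, the Wasserstein distance

A distribution function on the real line is represented by the probability measure it
determines; `cdf G` is the distribution function itself. -/

/-- Distributions on the real line with finite second moment. -/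
def M2 : Set (Measure ℝ) := {G | IsProbabilityMeasure G ∧ MemLp (fun x : ℝ => x) 2 G}

/-- The left-continuous quantile function `G⁻¹(u) = inf {y | G(y) ≥ u}`, for `0 < u < 1`. -/
def quantile (G : Measure ℝ) (u : ℝ) : ℝ := sInf {y : ℝ | u ≤ cdf G y}

/-- The right-continuous quantile function `G⁻¹⁺(u) = inf {y | G(y) > u}`, for `0 < u < 1`. -/
def quantileRight (G : Measure ℝ) (u : ℝ) : ℝ := sInf {y : ℝ | u < cdf G y}

/-- The quantile function extended to `[0, 1]` by its (possibly infinite) limits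
at the end points, `G⁻¹(0) = G⁻¹(0+)` and `G⁻¹(1) = G⁻¹(1-)`. -/
def quantileExt (G : Measure ℝ) (u : ℝ) : EReal :=
  if u ≤ 0 then ⨅ v ∈ Ioo (0 : ℝ) 1, (quantile G v : EReal)
  else if 1 ≤ u then ⨆ v ∈ Ioo (0 : ℝ) 1, (quantile G v : EReal)
  else (quantile G u : EReal)

/-- The couplings of two distributions. -/
def couplings (G₁ G₂ : Measure ℝ) : Set (Measure (ℝ × ℝ)) :=
  {π | π.map Prod.fst = G₁ ∧ π.map Prod.snd = G₂}

/-- The Wasserstein distance of order 2, `inf (E (X₁ - X₂)²)^(1/2)` over all couplings. -/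
def W2 (G₁ G₂ : Measure ℝ) : ENNReal :=
  ⨅ π ∈ couplings G₁ G₂, eLpNorm (fun z : ℝ × ℝ => z.1 - z.2) 2 π

/-- The uncertainty set: mean `μ`, standard deviation `σ`, and Wasserstein distance
at most `√ε` from the reference distribution `F`. -/
def uncertaintySet (F : Measure ℝ) (μ σ ε : ℝ) : Set (Measure ℝ) :=
  {G | G ∈ M2 ∧ ∫ x, x ∂G = μ ∧ ∫ x, x ^ 2 ∂G = μ ^ 2 + σ ^ 2 ∧
    W2 F G ≤ ENNReal.ofReal (√ε)}

/-! ### Moments under the uniform distribution on the unit interval -/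

/-- The uniform distribution on `(0, 1)`, the law of `U`. -/
def unif : Measure ℝ := volume.restrict (Ioo (0 : ℝ) 1)

/-- The standard deviation of `f(U)`. -/
def std (f : ℝ → ℝ) : ℝ := √(variance f unif)

/-- The correlation of `f(U)` and `g(U)`. -/
def corr (f g : ℝ → ℝ) : ℝ := covariance f g unif / (std f * std g)

/-- The law of `h(U)`: for a left-continuous non-decreasing `h` on `(0, 1)`, the distribution
whose quantile function is `h`. -/
def lawOf (h : ℝ → ℝ) : Measure ℝ := unif.map h

/-! ### Range Value-at-Risk -/

/-- The weight function of `RVaR_{α,β}`. -/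
def rvarWeight (α β u : ℝ) : ℝ := (Ioc α β).indicator (fun _ => 1 / (β - α)) u

/-- The distortion risk measure with weight function `γ`. -/
def distortionRisk (γ : ℝ → ℝ) (G : Measure ℝ) : ℝ := ∫ u, γ u * quantile G u ∂unif

/-- `RVaR_{α,β}`. -/
def RVaR (α β : ℝ) (G : Measure ℝ) : ℝ := distortionRisk (rvarWeight α β) G

/-- The best-case distributions: the minimisers of `RVaR_{α,β}` over the uncertainty set. -/
def bestCase (F : Measure ℝ) (μ σ ε α β : ℝ) : Set (Measure ℝ) :=
  {G | G ∈ uncertaintySet F μ σ ε ∧ ∀ G' ∈ uncertaintySet F μ σ ε, RVaR α β G ≤ RVaR α β G'}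

/-! ### The antitonic projection -/

/-- Square-integrable, non-increasing, left-continuous functions on `(0, 1)`. Values outside
`(0, 1)` are irrelevant. -/
def antitoneCone : Set (ℝ → ℝ) :=
  {k | AntitoneOn k (Ioo 0 1) ∧ (∀ u ∈ Ioo (0 : ℝ) 1, ContinuousWithinAt k (Iic u) u) ∧
    MemLp k 2 unif}

/-- `k` is a nearest point to `l` in the cone of non-increasing functions. -/
def IsAntitonicProjection (l k : ℝ → ℝ) : Prop :=
  k ∈ antitoneCone ∧ ∀ k' ∈ antitoneCone, ∫ u, (l u - k u) ^ 2 ∂unif ≤ ∫ u, (l u - k' u) ^ 2 ∂unif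

/-- The antitonic projection of `l`; it is determined on `(0, 1)`. -/
def antitonicProjection (l : ℝ → ℝ) : ℝ → ℝ := Classical.epsilon (IsAntitonicProjection l)

/-- The function `γ - lam F⁻¹` for `RVaR_{α,β}`. -/
def tilted (F : Measure ℝ) (α β lam u : ℝ) : ℝ := rvarWeight α β u - lam * quantile F u

/-- `k_lam^↓`, the antitonic projection of `γ - lam F⁻¹`. -/
def kDown (F : Measure ℝ) (α β lam : ℝ) : ℝ → ℝ := antitonicProjection (tilted F α β lam)

/-- `lam^↓ = inf {lam ≥ 0 | k_lam^↓ is not constant}`, with `inf ∅ = +∞`. -/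
def lambdaDown (F : Measure ℝ) (α β : ℝ) : EReal :=
  sInf {x : EReal | ∃ lam : ℝ, 0 ≤ lam ∧
    (¬ ∃ C : ℝ, ∀ u ∈ Ioo (0 : ℝ) 1, kDown F α β lam u = C) ∧ x = (lam : EReal)}

/-- `h_lam^↓ = μ + σ (a_lam - k_lam^↓) / b_lam`, where `a_lam` and `b_lam` are the mean and the
standard deviation of `k_lam^↓(U)`. -/
def hDown (F : Measure ℝ) (μ σ α β lam u : ℝ) : ℝ :=
  μ + σ * ((∫ v, kDown F α β lam v ∂unif) - kDown F α β lam u) / std (kDown F α β lam)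

/-! ### The explicit form of the projection -/

/-- The function equal to `-lam F⁻¹` outside `(z₀, β]`, to `-c` on `(z₀, z₁]`, and to
`-lam F⁻¹ + 1 / (β - α)` on `(z₁, β]`. -/
def blockForm (F : Measure ℝ) (α β lam z₀ z₁ c u : ℝ) : ℝ :=
  if u ≤ z₀ then -lam * quantile F u
  else if u ≤ z₁ then -c
  else if u ≤ β then -lam * quantile F u + 1 / (β - α)
  else -lam * quantile F u

/-- The conditions on `z₀`, `z₁`, `c`, for an arbitrary reference distribution `F`. A quantile
function may jump, so "`lam F⁻¹` takes the value `c` at `z₀`" reads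
`lam F⁻¹(z₀) ≤ c ≤ lam F⁻¹(z₀+)`, and likewise at `z₁`. If `z₀ = z₁` the block is empty
and there is no average to prescribe. -/
structure IsBlock (F : Measure ℝ) (α β lam z₀ z₁ c : ℝ) : Prop where
  zero_le : 0 ≤ z₀
  le_alpha : z₀ ≤ α
  alpha_le : α ≤ z₁
  le_beta : z₁ ≤ β
  left_end : (c : EReal) ≤ lam * quantileExt F 0 → z₀ = 0
  left_cross : lam * quantileExt F 0 < (c : EReal) →
    0 < z₀ ∧ lam * quantile F z₀ ≤ c ∧ c ≤ lam * quantileRight F z₀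
  right_cross : ((1 / (β - α) : ℝ) : EReal) < lam * quantileExt F β - c →
    z₁ < β ∧ lam * quantile F z₁ ≤ c + 1 / (β - α) ∧
      c + 1 / (β - α) ≤ lam * quantileRight F z₁
  right_end : lam * quantileExt F β - c ≤ ((1 / (β - α) : ℝ) : EReal) → z₁ = β
  average : z₀ < z₁ → c = -((z₁ - α) / (z₁ - z₀)) * (1 / (β - α)) +
    lam / (z₁ - z₀) * ∫ u in z₀..z₁, quantile F u

/-- The equations for `z₀`, `z₁`, `c` when the quantile function of `F` is continuous. -/
structure BlockEquations (F : Measure ℝ) (α β lam z₀ z₁ c : ℝ) : Prop where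
  lt : z₀ < z₁
  right_eq : ((1 / (β - α) : ℝ) : EReal) < lam * quantileExt F β - c →
    lam * quantileExt F z₁ = ((c + 1 / (β - α) : ℝ) : EReal)
  right_eq' : ((1 / (β - α) : ℝ) : EReal) < lam * quantileExt F β - c →
    lam * quantileExt F 0 ≤ (c : EReal) →
    lam * quantileExt F z₁ = lam * quantileExt F z₀ + ((1 / (β - α) : ℝ) : EReal)
  right_end : lam * quantileExt F β - c ≤ ((1 / (β - α) : ℝ) : EReal) →
    lam * quantileExt F z₁ = lam * quantileExt F β
  left_end : (c : EReal) ≤ lam * quantileExt F 0 →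
    lam * quantileExt F z₀ = lam * quantileExt F 0
  left_eq : lam * quantileExt F 0 < (c : EReal) → lam * quantileExt F z₀ = (c : EReal)
  average : c = -((z₁ - α) / (z₁ - z₀)) * (1 / (β - α)) +
    lam / (z₁ - z₀) * ∫ u in z₀..z₁, quantile F u

end BestCaseRVaR

end

namespace BestCaseRVaR

/-! ### Quantile functions -/

/-! Quantile functions turn the problem into geometry in `L²(0,1)`: the comonotone coupling has the
least quadratic cost, so the Wasserstein distance is the `L²` distance of quantile functions
(`W2_eq`). Write `Q = F⁻¹` and `x = G⁻¹`. Once the mean and standard deviation of `x` are fixed, the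
distance constraint is the linear inequality `⟪Q, x⟫ ≥ t`, and the objective `⟪γ, x⟫` is linear too.

For a multiplier `λ > 0` consider `ψ = λQ - γ` and its projection `g = -k_λ` onto the non-decreasing
cone. The variational inequality gives `⟪ψ, x⟫ ≤ ⟪g, x⟫` on the cone, with equality at affine images
of `g` of positive slope. By Cauchy–Schwarz for centred vectors, `⟪g, x⟫` is largest at the
rescaling `h_λ` of `g`, and the loss is a multiple of `‖x - h_λ‖²` (`inner_add_le_inner_rescaled`).
Hence `h_λ` is the only minimiser of the objective as soon as `⟪Q, h_λ⟫ = t`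
(`bestCase_eq_singleton`).

Such a `λ` exists by the intermediate value theorem: projections are nonexpansive, `g / λ → Q` at
infinity, `c₀` gives the limit at zero, and the bounds on `ε` place `t` strictly between the two
limits. If two multipliers worked, strict optimality would make their rescalings coincide;
`rescaled_projVec_eq` then makes `⟪Q, h_λ⟫` equal to `t` for all smaller `λ`, against the limit at
zero. That lemma eliminates `Q` between the two residuals. For `β < 1` an equality case of
Cauchy–Schwarz shows that the projections are affine images of the one at `λ = 0`. For `β = 1` the
assumption on `λ↓` makes `Q` unbounded, and the tails of `k_λ` rule out a coincidence.

The explicit form is verified through the variational inequality: the residual lives on the block,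
has mean zero, and changes sign only at `α` (`BlockBounds.isVariational`). The level `c` is found by
another intermediate value argument (`exists_isBlock`). -/

instance isProbabilityMeasure_unif : IsProbabilityMeasure unif :=
  ⟨by simp [unif]⟩

theorem ae_unif {p : ℝ → Prop} (h : ∀ u ∈ Ioo (0 : ℝ) 1, p u) : ∀ᵐ u ∂unif, p u :=
  (ae_restrict_iff' measurableSet_Ioo).2 (Eventually.of_forall h)

section Quantile

variable (G : Measure ℝ)

theorem exists_lt_cdf {u : ℝ} (hu : u < 1) : ∃ y, u < cdf G y :=
  ((tendsto_cdf_atTop G).eventually (eventually_gt_nhds hu)).exists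

theorem bddBelow_le_cdf {u : ℝ} (hu : 0 < u) : BddBelow {y : ℝ | u ≤ cdf G y} := by
  obtain ⟨b, hb⟩ := ((tendsto_cdf_atBot G).eventually (eventually_lt_nhds hu)).exists
  refine ⟨b, fun y hy => ?_⟩
  by_contra h
  exact absurd (monotone_cdf G (not_le.1 h).le) (not_le.2 (hb.trans_le hy))

/-- Right-continuity of the distribution function makes the infimum a minimum; this is the
nontrivial half of the Galois connection `quantile_le_iff`. -/
theorem le_cdf_quantile {u : ℝ} (hu : u ∈ Ioo (0 : ℝ) 1) : u ≤ cdf G (quantile G u) := by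
  have hne : {y : ℝ | u ≤ cdf G y}.Nonempty := (exists_lt_cdf G hu.2).imp fun _ h => h.le
  have ht : Tendsto (cdf G) (𝓝[>] (quantile G u)) (𝓝 (cdf G (quantile G u))) :=
    ((cdf G).right_continuous _).mono_left (nhdsWithin_mono _ Ioi_subset_Ici_self)
  refine ge_of_tendsto ht ?_
  filter_upwards [self_mem_nhdsWithin] with y hy
  obtain ⟨s, hs, hsy⟩ := exists_lt_of_csInf_lt hne hy
  exact le_trans hs (monotone_cdf G hsy.le)

theorem quantile_le_iff {u : ℝ} (hu : u ∈ Ioo (0 : ℝ) 1) (y : ℝ) :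
    quantile G u ≤ y ↔ u ≤ cdf G y :=
  ⟨fun h => (le_cdf_quantile G hu).trans (monotone_cdf G h),
    fun h => csInf_le (bddBelow_le_cdf G hu.1) h⟩

theorem monotoneOn_quantile : MonotoneOn (quantile G) (Ioo 0 1) := fun _ hu _ hv huv =>
  (quantile_le_iff G hu _).2 (huv.trans (le_cdf_quantile G hv))

theorem continuousWithinAt_quantile {u : ℝ} (hu : u ∈ Ioo (0 : ℝ) 1) :
    ContinuousWithinAt (quantile G) (Iic u) u := by
  refine tendsto_order.2 ⟨fun a ha => ?_, fun b hb => ?_⟩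
  · have h1 : cdf G a < u := not_le.1 fun h => absurd ((quantile_le_iff G hu a).2 h) (not_le.2 ha)
    filter_upwards [self_mem_nhdsWithin, nhdsWithin_le_nhds (Ioi_mem_nhds h1),
      nhdsWithin_le_nhds (Ioi_mem_nhds hu.1)] with v hv h2 h3
    exact not_le.1 fun h => absurd ((quantile_le_iff G ⟨h3, lt_of_le_of_lt hv hu.2⟩ a).1 h)
      (not_le.2 h2)
  · filter_upwards [self_mem_nhdsWithin, nhdsWithin_le_nhds (Ioi_mem_nhds hu.1)] with v hv h3
    exact (monotoneOn_quantile G ⟨h3, lt_of_le_of_lt hv hu.2⟩ hu hv).trans_lt hb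

/-- Together with `quantileRight_le` this makes `quantileRight G z` the infimum of the quantile
function to the right of `z`, so that crossing conditions at a jump become inequalities between
values on `(0, 1)`. -/
theorem le_quantileRight {a z : ℝ} (hz : z ∈ Ioo (0 : ℝ) 1)
    (h : ∀ u ∈ Ioo (0 : ℝ) 1, z < u → a ≤ quantile G u) : a ≤ quantileRight G z := by
  refine le_csInf (exists_lt_cdf G hz.2) fun y hy => ?_
  have hzu : z < min (cdf G y) ((z + 1) / 2) := lt_min hy (by linarith [hz.2])
  have hu : min (cdf G y) ((z + 1) / 2) ∈ Ioo (0 : ℝ) 1 :=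
    ⟨hz.1.trans hzu, (min_le_right _ _).trans_lt (by linarith [hz.2])⟩
  exact (h _ hu hzu).trans ((quantile_le_iff G hu y).2 (min_le_left _ _))

theorem quantileRight_le {z u : ℝ} (hz : z ∈ Ioo (0 : ℝ) 1) (hu : u ∈ Ioo (0 : ℝ) 1)
    (h : z < u) : quantileRight G z ≤ quantile G u :=
  csInf_le ⟨quantile G z, fun _ hy => (quantile_le_iff G hz _).2 (le_of_lt hy)⟩
    (h.trans_le (le_cdf_quantile G hu))

theorem quantileRight_eq (hc : ContinuousOn (quantile G) (Ioo 0 1)) {z : ℝ}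
    (hz : z ∈ Ioo (0 : ℝ) 1) : quantileRight G z = quantile G z := by
  refine le_antisymm ?_ (le_quantileRight G hz fun u hu h => monotoneOn_quantile G hz hu h.le)
  have ht : Tendsto (quantile G) (𝓝[>] z) (𝓝 (quantile G z)) :=
    ((hc.continuousAt (Ioo_mem_nhds hz.1 hz.2)).tendsto).mono_left nhdsWithin_le_nhds
  refine ge_of_tendsto ht ?_
  filter_upwards [self_mem_nhdsWithin, nhdsWithin_le_nhds (Ioo_mem_nhds hz.1 hz.2)] with u h1 h2
  exact quantileRight_le G hz h2 h1

theorem aemeasurable_quantile : AEMeasurable (quantile G) unif :=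
  aemeasurable_restrict_of_monotoneOn measurableSet_Ioo (monotoneOn_quantile G)

theorem unif_Iic {a : ℝ} (ha : a ≤ 1) : unif (Iic a) = ENNReal.ofReal a := by
  have h : (Iic a ∩ Ioo (0 : ℝ) 1 : Set ℝ) =ᵐ[volume] Ioc 0 a := by
    rw [show Ioc (0 : ℝ) a = Iic a ∩ Ioc 0 1 by
      ext x; simp only [mem_inter_iff, mem_Iic, mem_Ioc]; grind]
    exact (ae_eq_refl (Iic a)).inter Ioo_ae_eq_Ioc
  rw [unif, Measure.restrict_apply measurableSet_Iic, measure_congr h]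
  simp

variable [IsProbabilityMeasure G]

theorem map_quantile : unif.map (quantile G) = G := by
  have := Measure.isProbabilityMeasure_map (aemeasurable_quantile G)
  refine Measure.ext_of_Iic _ _ fun y => ?_
  rw [Measure.map_apply_of_aemeasurable (aemeasurable_quantile G) measurableSet_Iic, ← ofReal_cdf,
    ← unif_Iic (cdf_le_one G y)]
  refine measure_congr ?_
  filter_upwards [ae_unif (p := fun u => quantile G u ≤ y ↔ u ≤ cdf G y)
    fun u hu => quantile_le_iff G hu y] with u hu
  exact propext hu

theorem memLp_quantile (hG : MemLp (fun x : ℝ => x) 2 G) : MemLp (quantile G) 2 unif := by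
  have h := hG
  rw [← map_quantile G] at h
  exact (memLp_map_measure_iff aestronglyMeasurable_id (aemeasurable_quantile G)).1 h

theorem integral_quantile {f : ℝ → ℝ} (hf : Measurable f) :
    ∫ u, f (quantile G u) ∂unif = ∫ x, f x ∂G := by
  conv_rhs => rw [← map_quantile G]
  rw [integral_map (aemeasurable_quantile G) hf.aestronglyMeasurable]

end Quantile

theorem aemeasurable_of_monotoneOn {h : ℝ → ℝ} (hm : MonotoneOn h (Ioo 0 1)) :
    AEMeasurable h unif :=
  aemeasurable_restrict_of_monotoneOn measurableSet_Ioo hm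

theorem isProbabilityMeasure_lawOf {h : ℝ → ℝ} (hm : MonotoneOn h (Ioo 0 1)) :
    IsProbabilityMeasure (lawOf h) :=
  Measure.isProbabilityMeasure_map (aemeasurable_of_monotoneOn hm)

/-- Both sides satisfy the same Galois connection. Left-continuity enters in one direction: if `h u
> y`, then `h > y` already on some `(l, u]`, so `{h ≤ y}` has measure less than `u`. -/
theorem quantile_lawOf {h : ℝ → ℝ} (hm : MonotoneOn h (Ioo 0 1))
    (hc : ∀ u ∈ Ioo (0 : ℝ) 1, ContinuousWithinAt h (Iic u) u) {u : ℝ}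
    (hu : u ∈ Ioo (0 : ℝ) 1) : quantile (lawOf h) u = h u := by
  have := isProbabilityMeasure_lawOf hm
  have key : ∀ y, quantile (lawOf h) u ≤ y ↔ h u ≤ y := fun y => by
    rw [quantile_le_iff _ hu, cdf_eq_real, Measure.real,
      ← ENNReal.ofReal_le_iff_le_toReal (measure_ne_top _ _), lawOf,
      Measure.map_apply_of_aemeasurable (aemeasurable_of_monotoneOn hm) measurableSet_Iic]
    constructor
    · intro hle
      by_contra hlt
      obtain ⟨l, hl, hl'⟩ := (mem_nhdsLE_iff_exists_Ioc_subset' hu.1).1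
        ((hc u hu).eventually (eventually_gt_nhds (not_le.1 hlt)))
      have hlu : l < u := hl
      have h1 : unif (h ⁻¹' Iic y) ≤ unif (Iic (max l 0)) := by
        refine measure_mono_ae ?_
        refine ae_unif fun v hv (hvy : h v ≤ y) => ?_
        by_contra hv'
        have hlv : l < v := (le_max_left _ _).trans_lt (not_le.1 hv')
        rcases le_total v u with h2 | h2
        · exact absurd hvy (not_le.2 (hl' ⟨hlv, h2⟩))
        · exact absurd ((hm hu hv h2).trans hvy) hlt
      have hmax : max l 0 < u := max_lt hlu hu.1
      rw [unif_Iic (hmax.trans hu.2).le] at h1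
      exact absurd (hle.trans h1) (not_le.2 ((ENNReal.ofReal_lt_ofReal_iff hu.1).2 hmax))
    · intro hle
      rw [← unif_Iic hu.2.le]
      refine measure_mono_ae ?_
      filter_upwards [ae_unif (p := fun v => v ≤ u → h v ≤ y) fun v hv hvu =>
        (hm hv hu hvu).trans hle] with v hv
      exact hv
  exact le_antisymm ((key _).2 le_rfl) ((key _).1 le_rfl)

/-! ### The Wasserstein distance on the line -/

theorem measurableSet_triangle {X : Type*} [MeasurableSpace X] {a b c d : X → ℝ}
    (ha : Measurable a) (hb : Measurable b) (hc : Measurable c) (hd : Measurable d) :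
    MeasurableSet {z | a z ≤ b z ∧ b z ≤ c z ∧ c z < d z} :=
  (measurableSet_le ha hb).inter ((measurableSet_le hb hc).inter (measurableSet_lt hc hd))

/-- This writes the quadratic cost as a superposition of the events `X ≤ s ≤ t < Y`, on which
couplings can be compared pointwise in `(s, t)`. -/
theorem lintegral_triangle (x y : ℝ) :
    ∫⁻ p : ℝ × ℝ, {p : ℝ × ℝ | x ≤ p.1 ∧ p.1 ≤ p.2 ∧ p.2 < y}.indicator 1 p =
      ENNReal.ofReal (max (y - x) 0 ^ 2 / 2) := by
  have hmeas : MeasurableSet {p : ℝ × ℝ | x ≤ p.1 ∧ p.1 ≤ p.2 ∧ p.2 < y} :=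
    (measurableSet_le measurable_const measurable_fst).inter
      ((measurableSet_le measurable_fst measurable_snd).inter
        (measurableSet_lt measurable_snd measurable_const))
  rw [lintegral_indicator_one hmeas, Measure.volume_eq_prod, Measure.prod_apply hmeas]
  -- The slices are nonempty only for `s` in `[x, y)`; the point `s = x` is split off as a null set,
  -- so that the rest is an interval integral.
  have h1 : ∀ s : ℝ, volume (Prod.mk s ⁻¹' {p : ℝ × ℝ | x ≤ p.1 ∧ p.1 ≤ p.2 ∧ p.2 < y}) =
      (Ioc x y).indicator (fun s => ENNReal.ofReal (y - s)) s +
        ({x} : Set ℝ).indicator (fun s => ENNReal.ofReal (y - s)) s := fun s => by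
    rcases lt_trichotomy x s with h | h | h
    · have : Prod.mk s ⁻¹' {p : ℝ × ℝ | x ≤ p.1 ∧ p.1 ≤ p.2 ∧ p.2 < y} = Ico s y := by
        ext t; simp [h.le]
      rw [this, Real.volume_Ico]
      by_cases hs : s ≤ y
      · simp [indicator, h, hs, h.ne']
      · simp [indicator, hs, h.ne', ENNReal.ofReal_of_nonpos (by linarith : y - s ≤ 0)]
    · have : Prod.mk s ⁻¹' {p : ℝ × ℝ | x ≤ p.1 ∧ p.1 ≤ p.2 ∧ p.2 < y} = Ico s y := by
        ext t; simp [h.le]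
      rw [this, Real.volume_Ico]
      simp [indicator, h]
    · have : Prod.mk s ⁻¹' {p : ℝ × ℝ | x ≤ p.1 ∧ p.1 ≤ p.2 ∧ p.2 < y} = ∅ := by
        ext t; simp [h]
      rw [this]
      simp [indicator, h.not_gt, h.ne]
  simp_rw [h1]
  rw [lintegral_add_left ((by fun_prop : Measurable fun s : ℝ =>
    ENNReal.ofReal (y - s)).indicator measurableSet_Ioc), lintegral_indicator measurableSet_Ioc,
    lintegral_indicator (measurableSet_singleton x)]
  simp only [Measure.restrict_singleton, Real.volume_singleton, zero_smul, lintegral_zero_measure,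
    add_zero]
  rcases le_total x y with h | h
  · rw [← ofReal_integral_eq_lintegral_ofReal, ← intervalIntegral.integral_of_le h]
    · congr 1
      rw [max_eq_left (by linarith), intervalIntegral.integral_sub (by simp) (by simp)]
      simp
      ring
    · exact (by fun_prop : Continuous fun s : ℝ => y - s).integrableOn_Ioc
    · filter_upwards [ae_restrict_mem measurableSet_Ioc] with s hs
      exact sub_nonneg.2 hs.2
  · rw [Ioc_eq_empty (not_lt.2 h), max_eq_right (by linarith)]
    simp

theorem lintegral_lintegral_triangle (π : Measure (ℝ × ℝ)) [IsProbabilityMeasure π] :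
    ∫⁻ z, ENNReal.ofReal (max (z.2 - z.1) 0 ^ 2 / 2) ∂π =
      ∫⁻ p : ℝ × ℝ, π {z | z.1 ≤ p.1 ∧ p.1 ≤ p.2 ∧ p.2 < z.2} := by
  have hmeas : MeasurableSet {w : (ℝ × ℝ) × (ℝ × ℝ) |
      w.1.1 ≤ w.2.1 ∧ w.2.1 ≤ w.2.2 ∧ w.2.2 < w.1.2} :=
    measurableSet_triangle (by fun_prop) (by fun_prop) (by fun_prop) (by fun_prop)
  simp_rw [← lintegral_triangle]
  have hsw := lintegral_lintegral_swap (μ := π) (ν := (volume : Measure (ℝ × ℝ)))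
    (f := fun z p => {p : ℝ × ℝ | z.1 ≤ p.1 ∧ p.1 ≤ p.2 ∧ p.2 < z.2}.indicator 1 p)
    (((measurable_const (a := (1 : ENNReal))).indicator hmeas).aemeasurable)
  rw [hsw]
  refine lintegral_congr fun p => ?_
  rw [← lintegral_indicator_one]
  · rfl
  · exact measurableSet_triangle (by fun_prop) (by fun_prop) (by fun_prop) (by fun_prop)

theorem lintegral_sub_sq (π : Measure (ℝ × ℝ)) [IsProbabilityMeasure π] :
    ∫⁻ z, ENNReal.ofReal ((z.1 - z.2) ^ 2) ∂π =
      2 * ((∫⁻ p : ℝ × ℝ, π {z | z.1 ≤ p.1 ∧ p.1 ≤ p.2 ∧ p.2 < z.2}) +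
        ∫⁻ p : ℝ × ℝ, (π.map Prod.swap) {z | z.1 ≤ p.1 ∧ p.1 ≤ p.2 ∧ p.2 < z.2}) := by
  have := Measure.isProbabilityMeasure_map (μ := π) measurable_swap.aemeasurable
  rw [← lintegral_lintegral_triangle, ← lintegral_lintegral_triangle,
    lintegral_map (by fun_prop) measurable_swap, ← lintegral_add_left (by fun_prop),
    ← lintegral_const_mul _ (by fun_prop)]
  refine lintegral_congr fun z => ?_
  rw [← ENNReal.ofReal_add (by positivity) (by positivity), ← ENNReal.ofReal_ofNat,
    ← ENNReal.ofReal_mul (by norm_num)]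
  congr 1
  simp only [Prod.fst_swap, Prod.snd_swap]
  rcases le_total z.1 z.2 with h | h
  · rw [max_eq_left (by linarith), max_eq_right (by linarith)]; ring
  · rw [max_eq_right (by linarith), max_eq_left (by linarith)]; ring

theorem eLpNorm_two_sq {Ω : Type*} [MeasurableSpace Ω] (P : Measure Ω) (f : Ω → ℝ) :
    eLpNorm f 2 P ^ 2 = ∫⁻ z, ENNReal.ofReal (f z ^ 2) ∂P := by
  have h := eLpNorm_nnreal_pow_eq_lintegral (f := f) (μ := P) (p := 2) (by norm_num)
  norm_num at h
  rw [h]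
  refine lintegral_congr fun z => ?_
  rw [← ofReal_norm, ← ENNReal.ofReal_pow (norm_nonneg _), Real.norm_eq_abs, sq_abs]

section Coupling

variable (F G : Measure ℝ)

theorem aemeasurable_quantile_prod : AEMeasurable (fun u => (quantile F u, quantile G u)) unif :=
  (aemeasurable_quantile F).prodMk (aemeasurable_quantile G)

/-- The comonotone coupling. -/
noncomputable def quantileCoupling : Measure (ℝ × ℝ) :=
  unif.map fun u => (quantile F u, quantile G u)

/-- The event `X ≤ s` is covered by `X ≤ s, t < Y` and `Y ≤ t`, whatever the coupling. -/
theorem le_coupling_triangle [IsProbabilityMeasure F] [IsProbabilityMeasure G]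
    {π : Measure (ℝ × ℝ)} (h1 : π.map Prod.fst = F)
    (h2 : π.map Prod.snd = G) {s t : ℝ} (hst : s ≤ t) :
    ENNReal.ofReal (cdf F s - cdf G t) ≤ π {z | z.1 ≤ s ∧ s ≤ t ∧ t < z.2} := by
  rw [ENNReal.ofReal_sub _ (cdf_nonneg G t), ofReal_cdf, ofReal_cdf, ← h1, ← h2,
    Measure.map_apply measurable_fst measurableSet_Iic,
    Measure.map_apply measurable_snd measurableSet_Iic, tsub_le_iff_right]
  refine (measure_mono ?_).trans (measure_union_le _ _)
  intro z hz
  rcases le_or_gt z.2 t with h | h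
  · exact Or.inr h
  · exact Or.inl ⟨hz, hst, h⟩

theorem eLpNorm_quantileCoupling :
    eLpNorm (fun z : ℝ × ℝ => z.1 - z.2) 2 (quantileCoupling F G) =
      eLpNorm (fun u => quantile F u - quantile G u) 2 unif := by
  have hm : Measurable fun z : ℝ × ℝ => z.1 - z.2 := by fun_prop
  rw [quantileCoupling, eLpNorm_map_measure hm.aestronglyMeasurable
    (aemeasurable_quantile_prod F G)]
  rfl

theorem quantileCoupling_fst [IsProbabilityMeasure F] :
    (quantileCoupling F G).map Prod.fst = F := by
  rw [quantileCoupling, AEMeasurable.map_map_of_aemeasurable measurable_fst.aemeasurable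
    (aemeasurable_quantile_prod F G)]
  exact map_quantile F

theorem quantileCoupling_snd [IsProbabilityMeasure G] :
    (quantileCoupling F G).map Prod.snd = G := by
  rw [quantileCoupling, AEMeasurable.map_map_of_aemeasurable measurable_snd.aemeasurable
    (aemeasurable_quantile_prod F G)]
  exact map_quantile G

theorem quantileCoupling_swap : (quantileCoupling F G).map Prod.swap = quantileCoupling G F := by
  rw [quantileCoupling, AEMeasurable.map_map_of_aemeasurable measurable_swap.aemeasurable
    (aemeasurable_quantile_prod F G)]
  rfl

/-- For the comonotone coupling the event confines `u` to `(G(t), F(s)]`, so the lower bound valid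
for all couplings is attained. -/
theorem quantileCoupling_triangle (s t : ℝ) :
    quantileCoupling F G {z | z.1 ≤ s ∧ s ≤ t ∧ t < z.2} ≤
      ENNReal.ofReal (cdf F s - cdf G t) := by
  have hm : MeasurableSet {z : ℝ × ℝ | z.1 ≤ s ∧ s ≤ t ∧ t < z.2} :=
    measurableSet_triangle (by fun_prop) (by fun_prop) (by fun_prop) (by fun_prop)
  rw [quantileCoupling, Measure.map_apply_of_aemeasurable (aemeasurable_quantile_prod F G) hm,
    ← Real.volume_Ioc]
  refine le_trans ?_ (Measure.restrict_apply_le (Ioo 0 1) _)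
  refine measure_mono_ae ?_
  refine ae_unif fun u hu (h : quantile F u ≤ s ∧ s ≤ t ∧ t < quantile G u) =>
    ⟨?_, (quantile_le_iff F hu s).1 h.1⟩
  exact not_le.1 fun h' => absurd ((quantile_le_iff G hu t).2 h') (not_le.2 h.2.2)

variable [IsProbabilityMeasure F] [IsProbabilityMeasure G]

/-- The triangle events are least likely under the comonotone coupling, for every `(s, t)` and in
both orders of the marginals; integrating needs no moment assumption. -/
theorem eLpNorm_quantile_sub_le {π : Measure (ℝ × ℝ)} (h1 : π.map Prod.fst = F)
    (h2 : π.map Prod.snd = G) :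
    eLpNorm (fun u => quantile F u - quantile G u) 2 unif ≤
      eLpNorm (fun z : ℝ × ℝ => z.1 - z.2) 2 π := by
  have hπ : IsProbabilityMeasure π := by
    constructor
    have : F univ = 1 := measure_univ
    rwa [← h1, Measure.map_apply measurable_fst MeasurableSet.univ] at this
  have hQ : IsProbabilityMeasure (quantileCoupling F G) :=
    Measure.isProbabilityMeasure_map (aemeasurable_quantile_prod F G)
  have e1 : eLpNorm (fun u => quantile F u - quantile G u) 2 unif =
      eLpNorm (fun z : ℝ × ℝ => z.1 - z.2) 2 (quantileCoupling F G) :=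
    (eLpNorm_quantileCoupling F G).symm
  rw [e1, ← ENNReal.pow_le_pow_left_iff (two_ne_zero), eLpNorm_two_sq, eLpNorm_two_sq,
    lintegral_sub_sq, lintegral_sub_sq, quantileCoupling_swap]
  have aux : ∀ (F G : Measure ℝ) [IsProbabilityMeasure F] [IsProbabilityMeasure G]
      (π : Measure (ℝ × ℝ)), π.map Prod.fst = F → π.map Prod.snd = G → ∀ p : ℝ × ℝ,
      quantileCoupling F G {z | z.1 ≤ p.1 ∧ p.1 ≤ p.2 ∧ p.2 < z.2} ≤
        π {z | z.1 ≤ p.1 ∧ p.1 ≤ p.2 ∧ p.2 < z.2} := by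
    intro F G _ _ π h1 h2 p
    by_cases hp : p.1 ≤ p.2
    · exact (quantileCoupling_triangle F G _ _).trans (le_coupling_triangle F G h1 h2 hp)
    · simp [hp]
  refine mul_le_mul_right (add_le_add (lintegral_mono fun p => aux F G π h1 h2 p)
    (lintegral_mono fun p => aux G F _ ?_ ?_ p)) _
  · rw [Measure.map_map measurable_fst measurable_swap]; exact h2
  · rw [Measure.map_map measurable_snd measurable_swap]; exact h1

theorem W2_eq : W2 F G = eLpNorm (fun u => quantile F u - quantile G u) 2 unif := by
  refine le_antisymm ?_ (le_iInf₂ fun π hπ => eLpNorm_quantile_sub_le F G hπ.1 hπ.2)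
  refine (iInf₂_le (quantileCoupling F G)
    ⟨quantileCoupling_fst F G, quantileCoupling_snd F G⟩).trans_eq ?_
  exact eLpNorm_quantileCoupling F G

theorem W2_eq_ofReal (hF : MemLp (quantile F) 2 unif) (hG : MemLp (quantile G) 2 unif) :
    W2 F G = ENNReal.ofReal (√(∫ u, (quantile F u - quantile G u) ^ 2 ∂unif)) := by
  have h : MemLp (fun u => quantile F u - quantile G u) 2 unif := hF.sub hG
  rw [W2_eq, ← (ENNReal.pow_right_strictMono two_ne_zero).injective.eq_iff, eLpNorm_two_sq,
    ← ENNReal.ofReal_pow (Real.sqrt_nonneg _),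
    Real.sq_sqrt (integral_nonneg fun _ => sq_nonneg _), ofReal_integral_eq_lintegral_ofReal
      h.integrable_sq (Eventually.of_forall fun _ => sq_nonneg _)]

end Coupling

/-! ### The antitonic projection and its variational characterisation -/

/-- Left-continuous functions that differ at `u` differ on a whole interval ending at `u`, which has
positive measure. -/
theorem eqOn_of_ae_eq {f g : ℝ → ℝ} (hf : ∀ u ∈ Ioo (0 : ℝ) 1, ContinuousWithinAt f (Iic u) u)
    (hg : ∀ u ∈ Ioo (0 : ℝ) 1, ContinuousWithinAt g (Iic u) u) (h : f =ᵐ[unif] g) :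
    ∀ u ∈ Ioo (0 : ℝ) 1, f u = g u := by
  intro u hu
  by_contra hne
  have hev : ∀ᶠ v in 𝓝[≤] u, f v - g v ≠ 0 :=
    ((hf u hu).sub (hg u hu)).eventually_ne (sub_ne_zero.2 hne)
  obtain ⟨l, hl, hl'⟩ := (mem_nhdsLE_iff_exists_Ioc_subset' hu.1).1 hev
  have hlt : max l 0 < u := max_lt hl hu.1
  have hsub : Ioo (max l 0) u ⊆ {v | ¬ f v = g v} := fun v hv =>
    sub_ne_zero.1 (hl' ⟨(le_max_left _ _).trans_lt hv.1, hv.2.le⟩)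
  have h0 : unif (Ioo (max l 0) u) = 0 := measure_mono_null hsub h
  rw [unif, Measure.restrict_apply measurableSet_Ioo, inter_eq_left.2
    (Ioo_subset_Ioo (le_max_right _ _) hu.2.le), Real.volume_Ioo, ENNReal.ofReal_eq_zero] at h0
  linarith

/-- The variational inequality that characterises the projection onto the cone of
non-increasing functions. -/
structure IsVariational (l k : ℝ → ℝ) : Prop where
  mem : k ∈ antitoneCone
  le : ∀ f ∈ antitoneCone, ∫ u, (l u - k u) * f u ∂unif ≤ 0
  eq : ∫ u, (l u - k u) * k u ∂unif = 0

/-- Pythagoras with an inequality: expanding about `k`, the cross term has a favourable sign. This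
yields minimality of `k` and its uniqueness at once. -/
theorem IsVariational.integral_add_le {l k f : ℝ → ℝ} (h : IsVariational l k)
    (hl : MemLp l 2 unif) (hf : f ∈ antitoneCone) :
    ∫ u, (l u - k u) ^ 2 ∂unif + ∫ u, (k u - f u) ^ 2 ∂unif ≤ ∫ u, (l u - f u) ^ 2 ∂unif := by
  have hk := h.mem.2.2
  have hf' := hf.2.2
  have i1 : Integrable (fun u => (l u - k u) ^ 2) unif := (hl.sub hk).integrable_sq
  have i2 : Integrable (fun u => (k u - f u) ^ 2) unif := (hk.sub hf').integrable_sq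
  have i3 : Integrable (fun u => (l u - k u) * k u) unif := (hl.sub hk).integrable_mul hk
  have i4 : Integrable (fun u => (l u - k u) * f u) unif := (hl.sub hk).integrable_mul hf'
  have e : ∫ u, (l u - f u) ^ 2 ∂unif = ∫ u, ((l u - k u) ^ 2 + (k u - f u) ^ 2) +
      2 * ((l u - k u) * k u - (l u - k u) * f u) ∂unif := by
    refine integral_congr_ae (Eventually.of_forall fun u => ?_)
    simp only
    ring
  have i34 : Integrable (fun u => 2 * ((l u - k u) * k u - (l u - k u) * f u)) unif :=
    (i3.sub i4).const_mul 2
  have i12 : Integrable (fun u => (l u - k u) ^ 2 + (k u - f u) ^ 2) unif := i1.add i2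
  rw [e, integral_add i12 i34, integral_add i1 i2, integral_const_mul, integral_sub i3 i4, h.eq]
  linarith [h.le f hf]

theorem IsVariational.isAntitonicProjection {l k : ℝ → ℝ} (h : IsVariational l k)
    (hl : MemLp l 2 unif) : IsAntitonicProjection l k :=
  ⟨h.mem, fun _ hf => le_trans (le_add_of_nonneg_right (integral_nonneg fun _ => sq_nonneg _))
    (h.integral_add_le hl hf)⟩

theorem IsVariational.eqOn {l k k' : ℝ → ℝ} (h : IsVariational l k)
    (hl : MemLp l 2 unif) (h' : IsAntitonicProjection l k') :
    ∀ u ∈ Ioo (0 : ℝ) 1, k' u = k u := by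
  have h1 := h.integral_add_le hl h'.1
  have h2 := h'.2 k h.mem
  have h3 : ∫ u, (k u - k' u) ^ 2 ∂unif = 0 :=
    le_antisymm (by linarith) (integral_nonneg fun _ => sq_nonneg _)
  have i : Integrable (fun u => (k u - k' u) ^ 2) unif := (h.mem.2.2.sub h'.1.2.2).integrable_sq
  rw [integral_eq_zero_iff_of_nonneg (fun _ => sq_nonneg _) i] at h3
  refine eqOn_of_ae_eq h'.1.2.1 h.mem.2.1 ?_
  filter_upwards [h3] with u hu
  have : k u - k' u = 0 := by simpa using hu
  linarith

theorem IsVariational.antitonicProjection {l k : ℝ → ℝ} (h : IsVariational l k)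
    (hl : MemLp l 2 unif) : IsAntitonicProjection l (antitonicProjection l) :=
  Classical.epsilon_spec ⟨k, h.isAntitonicProjection hl⟩

theorem IsVariational.antitonicProjection_eqOn {l k : ℝ → ℝ} (h : IsVariational l k)
    (hl : MemLp l 2 unif) : ∀ u ∈ Ioo (0 : ℝ) 1, BestCaseRVaR.antitonicProjection l u = k u :=
  h.eqOn hl (h.antitonicProjection hl)

theorem IsVariational.congr {l k k' : ℝ → ℝ} (h : IsVariational l k) (hk' : k' ∈ antitoneCone)
    (he : ∀ u ∈ Ioo (0 : ℝ) 1, k' u = k u) : IsVariational l k' := by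
  have e := ae_unif he
  refine ⟨hk', fun f hf => le_of_eq_of_le (integral_congr_ae ?_) (h.le f hf),
    (integral_congr_ae ?_).trans h.eq⟩
  · filter_upwards [e] with u hu
    rw [hu]
  · filter_upwards [e] with u hu
    rw [hu]

/-! ### Extended quantiles -/

section Ext

variable (F : Measure ℝ)

theorem le_mul_quantileExt_zero {lam c : ℝ} (hl : 0 ≤ lam) :
    (c : EReal) ≤ lam * quantileExt F 0 ↔ ∀ u ∈ Ioo (0 : ℝ) 1, c ≤ lam * quantile F u := by
  rcases hl.eq_or_lt with rfl | hl
  · have h : c ≤ 0 ↔ ∀ u ∈ Ioo (0 : ℝ) 1, c ≤ 0 * quantile F u :=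
      ⟨fun h u _ => by simpa using h,
        fun h => by simpa using h (1 / 2) ⟨by norm_num, by norm_num⟩⟩
    rw [← h]
    simp
  · rw [← EReal.div_le_iff_le_mul (EReal.coe_pos.2 hl) (EReal.coe_ne_top _), quantileExt,
      if_pos le_rfl, le_iInf₂_iff]
    refine forall₂_congr fun u _ => ?_
    rw [← EReal.coe_div, EReal.coe_le_coe_iff, div_le_iff₀' hl]

theorem mul_quantileExt_sub_le {lam c r β : ℝ} (hl : 0 ≤ lam)
    (hβ0 : 0 < β) (hβ : β ≤ 1) :
    lam * quantileExt F β - (c : EReal) ≤ (r : EReal) ↔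
      ∀ u ∈ Ioo (0 : ℝ) 1, u ≤ β → lam * quantile F u ≤ c + r := by
  have hs : lam * quantileExt F β - (c : EReal) ≤ (r : EReal) ↔
      lam * quantileExt F β ≤ ((c + r : ℝ) : EReal) := by
    rw [EReal.sub_le_iff_le_add (by simp) (by simp), ← EReal.coe_add, add_comm r c]
  rw [hs]
  rcases hl.eq_or_lt with rfl | hl
  · have h : 0 ≤ c + r ↔ ∀ u ∈ Ioo (0 : ℝ) 1, u ≤ β → 0 * quantile F u ≤ c + r :=
      ⟨fun h u _ _ => by simpa using h,
        fun h => by simpa using h (β / 2) ⟨by linarith, by linarith⟩ (by linarith)⟩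
    rw [← h, ← EReal.coe_le_coe_iff]
    simp
  · rw [mul_comm, ← EReal.le_div_iff_mul_le (EReal.coe_pos.2 hl) (EReal.coe_ne_top _),
      ← EReal.coe_div, quantileExt, if_neg (not_le.2 hβ0)]
    split_ifs with h1
    · rw [iSup₂_le_iff]
      refine forall₂_congr fun u hu => ?_
      rw [EReal.coe_le_coe_iff, le_div_iff₀' hl]
      exact ⟨fun h _ => h, fun h => h (hu.2.le.trans h1)⟩
    · rw [EReal.coe_le_coe_iff, le_div_iff₀' hl]
      have hb : β ∈ Ioo (0 : ℝ) 1 := ⟨hβ0, not_le.1 h1⟩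
      exact ⟨fun h u hu huβ => (mul_le_mul_of_nonneg_left
        (monotoneOn_quantile F hu hb huβ) hl.le).trans h, fun h => h β hb le_rfl⟩

end Ext

/-! ### Block forms are projections -/

/-- The inequalities satisfied by the parameters of a block, in terms of the quantile function
on `(0, 1)` only. -/
structure BlockBounds (F : Measure ℝ) (α β lam z₀ z₁ c : ℝ) : Prop where
  zero_le : 0 ≤ z₀
  le_alpha : z₀ ≤ α
  alpha_le : α ≤ z₁
  le_beta : z₁ ≤ β
  left_le : ∀ u ∈ Ioo (0 : ℝ) 1, u ≤ z₀ → lam * quantile F u ≤ c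
  left_ge : ∀ u ∈ Ioo (0 : ℝ) 1, z₀ < u → c ≤ lam * quantile F u
  right_le : ∀ u ∈ Ioo (0 : ℝ) 1, u ≤ z₁ → lam * quantile F u ≤ c + 1 / (β - α)
  right_ge : ∀ u ∈ Ioo (0 : ℝ) 1, z₁ < u → u ≤ β → c + 1 / (β - α) ≤ lam * quantile F u
  average : (z₁ - α) * (1 / (β - α)) + c * (z₁ - z₀) - lam * ∫ u in z₀..z₁, quantile F u = 0

section Block

variable {F : Measure ℝ} {α β lam z₀ z₁ c : ℝ}

theorem IsBlock.bounds (hα : 0 < α) (hαβ : α < β) (hβ : β ≤ 1) (hl : 0 ≤ lam)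
    (h : IsBlock F α β lam z₀ z₁ c) : BlockBounds F α β lam z₀ z₁ c := by
  have hz1 : 0 < z₁ := hα.trans_le h.alpha_le
  have left : (∀ u ∈ Ioo (0 : ℝ) 1, u ≤ z₀ → lam * quantile F u ≤ c) ∧
      ∀ u ∈ Ioo (0 : ℝ) 1, z₀ < u → c ≤ lam * quantile F u := by
    rcases le_or_gt (c : EReal) (lam * quantileExt F 0) with hc | hc
    · have hz := h.left_end hc
      refine ⟨fun u hu h' => absurd hu.1 (by rw [hz] at h'; exact not_lt.2 h'),
        fun u hu _ => (le_mul_quantileExt_zero F hl).1 hc u hu⟩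
    · obtain ⟨h0, h1, h2⟩ := h.left_cross hc
      have hz : z₀ ∈ Ioo (0 : ℝ) 1 := ⟨h0, by linarith [h.le_alpha]⟩
      exact ⟨fun u hu h' =>
        (mul_le_mul_of_nonneg_left (monotoneOn_quantile F hu hz h') hl).trans h1,
        fun u hu h' => h2.trans (mul_le_mul_of_nonneg_left (quantileRight_le F hz hu h') hl)⟩
  have right : (∀ u ∈ Ioo (0 : ℝ) 1, u ≤ z₁ → lam * quantile F u ≤ c + 1 / (β - α)) ∧
      ∀ u ∈ Ioo (0 : ℝ) 1, z₁ < u → u ≤ β → c + 1 / (β - α) ≤ lam * quantile F u := by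
    rcases le_or_gt (lam * quantileExt F β - c) ((1 / (β - α) : ℝ) : EReal) with hc | hc
    · have hz := h.right_end hc
      refine ⟨fun u hu h' => (mul_quantileExt_sub_le F hl (hα.trans hαβ) hβ).1 hc u hu (hz ▸ h'),
        fun u hu h1 h2 => absurd h1 (by rw [hz]; exact not_lt.2 h2)⟩
    · obtain ⟨h0, h1, h2⟩ := h.right_cross hc
      have hz : z₁ ∈ Ioo (0 : ℝ) 1 := ⟨hz1, by linarith⟩
      exact ⟨fun u hu h' =>
        (mul_le_mul_of_nonneg_left (monotoneOn_quantile F hu hz h') hl).trans h1,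
        fun u hu h' _ => h2.trans (mul_le_mul_of_nonneg_left (quantileRight_le F hz hu h') hl)⟩
  refine ⟨h.zero_le, h.le_alpha, h.alpha_le, h.le_beta, left.1, left.2, right.1, right.2, ?_⟩
  -- An empty block forces `z₀ = z₁ = α`, and the balance equation, free of denominators, holds
  -- trivially.
  rcases (h.le_alpha.trans h.alpha_le).eq_or_lt with he | hlt
  · have e1 : z₁ = α := le_antisymm (he ▸ h.le_alpha) h.alpha_le
    rw [he]
    simp [e1]
  · have ha := h.average hlt
    have h1 : z₁ - z₀ ≠ 0 := (sub_pos.2 hlt).ne'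
    have h2 : β - α ≠ 0 := (sub_pos.2 hαβ).ne'
    generalize (∫ u in z₀..z₁, quantile F u) = I at ha ⊢
    rw [ha]
    field_simp
    ring

theorem continuousWithinAt_blockForm (u : ℝ) (hu : u ∈ Ioo (0 : ℝ) 1) :
    ContinuousWithinAt (blockForm F α β lam z₀ z₁ c) (Iic u) u := by
  have hQ := (continuousWithinAt_quantile F hu).const_mul (-lam)
  have hI : ∀ {a : ℝ}, a < u → ∀ᶠ v in 𝓝[≤] u, a < v := fun h =>
    nhdsWithin_le_nhds (Ioi_mem_nhds h)
  by_cases h0 : u ≤ z₀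
  · refine hQ.congr (fun v hv => ?_) ?_
    · rw [blockForm, if_pos (le_trans hv h0)]
    · rw [blockForm, if_pos h0]
  rw [not_le] at h0
  by_cases h1 : u ≤ z₁
  · refine (continuousWithinAt_const (b := -c)).congr_of_eventuallyEq ?_ ?_
    · filter_upwards [self_mem_nhdsWithin, hI h0] with v hv hv0
      rw [blockForm, if_neg (not_le.2 hv0), if_pos (le_trans hv h1)]
    · rw [blockForm, if_neg (not_le.2 h0), if_pos h1]
  rw [not_le] at h1
  by_cases h2 : u ≤ β
  · refine (hQ.add_const (1 / (β - α))).congr_of_eventuallyEq ?_ ?_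
    · filter_upwards [self_mem_nhdsWithin, hI h0, hI h1] with v hv hv0 hv1
      rw [blockForm, if_neg (not_le.2 hv0), if_neg (not_le.2 hv1), if_pos (le_trans hv h2)]
    · rw [blockForm, if_neg (not_le.2 h0), if_neg (not_le.2 h1), if_pos h2]
  rw [not_le] at h2
  refine hQ.congr_of_eventuallyEq ?_ ?_
  · filter_upwards [hI h0, hI h1, hI h2] with v hv0 hv1 hv2
    rw [blockForm, if_neg (not_le.2 hv0), if_neg (not_le.2 hv1), if_neg (not_le.2 hv2)]
  · rw [blockForm, if_neg (not_le.2 h0), if_neg (not_le.2 h1), if_neg (not_le.2 h2)]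

theorem BlockBounds.antitoneOn (hαβ : α < β) (hl : 0 ≤ lam)
    (h : BlockBounds F α β lam z₀ z₁ c) :
    AntitoneOn (blockForm F α β lam z₀ z₁ c) (Ioo 0 1) := by
  intro u hu v hv huv
  have hr : 0 < 1 / (β - α) := one_div_pos.2 (sub_pos.2 hαβ)
  have hm := mul_le_mul_of_nonneg_left (monotoneOn_quantile F hu hv huv) hl
  have a1 := h.left_le u hu
  have a2 := h.left_ge v hv
  have a3 := h.right_ge v hv
  have := h.le_alpha
  have := h.alpha_le
  have := h.le_beta
  unfold blockForm
  split_ifs <;> grind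

/-- The block form differs from `-lam F⁻¹` by a bounded function; square-integrability follows from
this. -/
theorem BlockBounds.sandwich (hαβ : α < β) (h : BlockBounds F α β lam z₀ z₁ c)
    {u : ℝ} (hu : u ∈ Ioo (0 : ℝ) 1) :
    0 ≤ blockForm F α β lam z₀ z₁ c u + lam * quantile F u ∧
      blockForm F α β lam z₀ z₁ c u + lam * quantile F u ≤ 1 / (β - α) := by
  have hr : 0 < 1 / (β - α) := one_div_pos.2 (sub_pos.2 hαβ)
  have a2 := h.left_ge u hu
  have a3 := h.right_le u hu
  unfold blockForm
  split_ifs <;> constructor <;> grind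

theorem memLp_of_antitone_of_bound {k q : ℝ → ℝ} (hk : AntitoneOn k (Ioo 0 1))
    (hq : MemLp q 2 unif) {r : ℝ} (hb : ∀ u ∈ Ioo (0 : ℝ) 1, |k u + q u| ≤ r) :
    MemLp k 2 unif := by
  have hm : AEMeasurable k unif := aemeasurable_restrict_of_antitoneOn measurableSet_Ioo hk
  have h1 : MemLp (fun u => k u + q u) 2 unif :=
    MemLp.of_bound (hm.aestronglyMeasurable.add hq.1) r (ae_unif hb)
  refine (h1.sub hq).ae_eq (Eventually.of_forall fun u => ?_)
  simp

theorem BlockBounds.mem_antitoneCone (hF : MemLp (quantile F) 2 unif) (hαβ : α < β)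
    (hl : 0 ≤ lam) (h : BlockBounds F α β lam z₀ z₁ c) :
    blockForm F α β lam z₀ z₁ c ∈ antitoneCone := by
  refine ⟨h.antitoneOn hαβ hl, continuousWithinAt_blockForm,
    memLp_of_antitone_of_bound (h.antitoneOn hαβ hl) (hF.const_mul lam) (r := 1 / (β - α))
    fun u hu => ?_⟩
  obtain ⟨h1, h2⟩ := h.sandwich hαβ hu
  rwa [abs_of_nonneg h1]

theorem memLp_rvarWeight : MemLp (rvarWeight α β) 2 unif :=
  (memLp_const (1 / (β - α))).indicator measurableSet_Ioc

theorem memLp_tilted (hF : MemLp (quantile F) 2 unif) : MemLp (tilted F α β lam) 2 unif :=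
  memLp_rvarWeight.sub (hF.const_mul lam)

theorem integral_unif_indicator {f : ℝ → ℝ} {a b : ℝ} (ha : 0 ≤ a) (hab : a ≤ b) (hb : b ≤ 1) :
    ∫ u, (Ioc a b).indicator f u ∂unif = ∫ u in a..b, f u := by
  rw [unif, restrict_Ioo_eq_restrict_Ioc, integral_indicator measurableSet_Ioc,
    Measure.restrict_restrict measurableSet_Ioc, inter_eq_left.2 (Ioc_subset_Ioc ha hb),
    intervalIntegral.integral_of_le hab]

theorem intervalIntegrable_of_unif {f : ℝ → ℝ} (hf : Integrable f unif) {a b : ℝ} (ha : 0 ≤ a)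
    (hab : a ≤ b) (hb : b ≤ 1) : IntervalIntegrable f volume a b := by
  rw [unif, restrict_Ioo_eq_restrict_Ioc] at hf
  rw [intervalIntegrable_iff_integrableOn_Ioc_of_le hab]
  exact IntegrableOn.mono_set hf (Ioc_subset_Ioc ha hb)

theorem integral_rvarWeight (ha : z₀ ≤ α) (hb : α ≤ z₁) (hc : z₁ ≤ β) :
    ∫ u in z₀..z₁, rvarWeight α β u = (z₁ - α) * (1 / (β - α)) := by
  have h : ∀ u ∈ Ioc z₀ z₁, rvarWeight α β u =
      (Ioc α z₁).indicator (fun _ => 1 / (β - α)) u := fun u hu => by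
    unfold rvarWeight indicator
    have h1 := hu.1
    have h2 := hu.2
    congr 1
    simp only [mem_Ioc, eq_iff_iff]
    grind
  rw [intervalIntegral.integral_of_le (ha.trans hb), setIntegral_congr_fun measurableSet_Ioc h,
    setIntegral_indicator measurableSet_Ioc, inter_eq_right.2 (Ioc_subset_Ioc_left ha),
    setIntegral_const, Real.volume_real_Ioc_of_le hb, smul_eq_mul]

theorem integral_block (hF : Integrable (quantile F) unif) (h0 : 0 ≤ z₀) (ha : z₀ ≤ α)
    (hb : α ≤ z₁) (hc : z₁ ≤ β) (hβ : β ≤ 1) :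
    ∫ u, (Ioc z₀ z₁).indicator (fun u => rvarWeight α β u + c - lam * quantile F u) u ∂unif =
      (z₁ - α) * (1 / (β - α)) + c * (z₁ - z₀) - lam * ∫ u in z₀..z₁, quantile F u := by
  have hz := ha.trans hb
  have h1 := hc.trans hβ
  have i1 : IntervalIntegrable (rvarWeight α β) volume z₀ z₁ :=
    intervalIntegrable_of_unif (memLp_rvarWeight.integrable one_le_two) h0 hz h1
  have i2 := intervalIntegrable_of_unif hF h0 hz h1
  rw [integral_unif_indicator h0 hz h1, intervalIntegral.integral_sub (i1.add (by simp))
    (i2.const_mul lam), intervalIntegral.integral_add i1 (by simp), integral_rvarWeight ha hb hc,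
    intervalIntegral.integral_const, intervalIntegral.integral_const_mul, smul_eq_mul]
  ring

theorem BlockBounds.tilted_sub (h : BlockBounds F α β lam z₀ z₁ c) (u : ℝ) :
    tilted F α β lam u - blockForm F α β lam z₀ z₁ c u =
      (Ioc z₀ z₁).indicator (fun u => rvarWeight α β u + c - lam * quantile F u) u := by
  have := h.le_alpha
  have := h.alpha_le
  have := h.le_beta
  unfold tilted blockForm rvarWeight indicator
  simp only [mem_Ioc]
  split_ifs <;> grind

theorem BlockBounds.isVariational (hF : MemLp (quantile F) 2 unif) (hα : 0 < α) (hαβ : α < β)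
    (hβ : β ≤ 1) (hl : 0 ≤ lam) (h : BlockBounds F α β lam z₀ z₁ c) :
    IsVariational (tilted F α β lam) (blockForm F α β lam z₀ z₁ c) := by
  have hk := h.mem_antitoneCone hF hαβ hl
  have hm0 : ∫ u, (tilted F α β lam u - blockForm F α β lam z₀ z₁ c u) ∂unif = 0 := by
    simp_rw [h.tilted_sub]
    rw [integral_block (hF.integrable one_le_two) h.zero_le h.le_alpha h.alpha_le h.le_beta hβ]
    exact h.average
  have hmL : MemLp (fun u => tilted F α β lam u - blockForm F α β lam z₀ z₁ c u) 2 unif :=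
    (memLp_tilted hF).sub hk.2.2
  refine ⟨hk, fun f hf => ?_, ?_⟩
  -- As the residual has mean zero, `f α` may be subtracted from `f`. The residual is nonpositive up
  -- to `α` and nonnegative beyond, while `f - f α` has the opposite signs.
  · have e : ∫ u, (tilted F α β lam u - blockForm F α β lam z₀ z₁ c u) * f u ∂unif =
        ∫ u, (tilted F α β lam u - blockForm F α β lam z₀ z₁ c u) * (f u - f α) ∂unif := by
      simp_rw [mul_sub]
      have i1 : Integrable (fun u => (tilted F α β lam u - blockForm F α β lam z₀ z₁ c u) * f u)
        unif := hmL.integrable_mul hf.2.2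
      rw [integral_sub i1 ((hmL.integrable one_le_two).mul_const _),
        integral_mul_const, hm0, zero_mul, sub_zero]
    rw [e]
    refine integral_nonpos_of_ae (ae_unif fun u hu => ?_)
    simp only [Pi.zero_apply]
    rw [h.tilted_sub]
    have hα1 : α ∈ Ioo (0 : ℝ) 1 := ⟨hα, by linarith⟩
    by_cases hz : u ∈ Ioc z₀ z₁
    · rw [indicator_of_mem hz]
      rcases le_or_gt u α with hu' | hu'
      · have : rvarWeight α β u = 0 := indicator_of_notMem (fun h' => absurd h'.1 (not_lt.2 hu')) _
        have h1 := h.left_ge u hu hz.1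
        exact mul_nonpos_of_nonpos_of_nonneg (by linarith) (sub_nonneg.2 (hf.1 hu hα1 hu'))
      · have : rvarWeight α β u = 1 / (β - α) :=
          indicator_of_mem (show u ∈ Ioc α β from ⟨hu', hz.2.trans h.le_beta⟩) _
        have h1 := h.right_le u hu hz.2
        exact mul_nonpos_of_nonneg_of_nonpos (by linarith) (sub_nonpos.2 (hf.1 hα1 hu hu'.le))
    · rw [indicator_of_notMem hz, zero_mul]
  -- Where the residual does not vanish, the block form is the constant `-c`.
  · have e : ∀ u, (tilted F α β lam u - blockForm F α β lam z₀ z₁ c u) *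
        blockForm F α β lam z₀ z₁ c u =
        (tilted F α β lam u - blockForm F α β lam z₀ z₁ c u) * (-c) := fun u => by
      by_cases hz : u ∈ Ioc z₀ z₁
      · rw [show blockForm F α β lam z₀ z₁ c u = -c by
          rw [blockForm, if_neg (not_le.2 hz.1), if_pos hz.2]]
      · rw [h.tilted_sub, indicator_of_notMem hz, zero_mul, zero_mul]
    simp_rw [e]
    rw [integral_mul_const, hm0, zero_mul]

theorem BlockBounds.kDown_eq (hF : MemLp (quantile F) 2 unif) (hα : 0 < α) (hαβ : α < β)
    (hβ : β ≤ 1) (hl : 0 ≤ lam) (h : BlockBounds F α β lam z₀ z₁ c) :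
    ∀ u ∈ Ioo (0 : ℝ) 1, kDown F α β lam u = blockForm F α β lam z₀ z₁ c u :=
  (h.isVariational hF hα hαβ hβ hl).antitonicProjection_eqOn (memLp_tilted hF)

theorem BlockBounds.isAntitonicProjection_kDown (hF : MemLp (quantile F) 2 unif) (hα : 0 < α)
    (hαβ : α < β) (hβ : β ≤ 1) (hl : 0 ≤ lam) (h : BlockBounds F α β lam z₀ z₁ c) :
    IsAntitonicProjection (tilted F α β lam) (kDown F α β lam) :=
  (h.isVariational hF hα hαβ hβ hl).antitonicProjection (memLp_tilted hF)

theorem BlockBounds.isVariational_kDown (hF : MemLp (quantile F) 2 unif) (hα : 0 < α)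
    (hαβ : α < β) (hβ : β ≤ 1) (hl : 0 ≤ lam) (h : BlockBounds F α β lam z₀ z₁ c) :
    IsVariational (tilted F α β lam) (kDown F α β lam) :=
  (h.isVariational hF hα hαβ hβ hl).congr (h.isAntitonicProjection_kDown hF hα hαβ hβ hl).1
    (h.kDown_eq hF hα hαβ hβ hl)

/-! ### Existence of blocks -/

/-- The level is crossed at the supremum of the sublevel set; left-continuity keeps the inequality
at that point. -/
theorem exists_level (hl : 0 ≤ lam) {b d u₀ : ℝ} (hu₀ : u₀ ∈ Ioo (0 : ℝ) 1) (hb : u₀ ≤ b)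
    (hd : lam * quantile F u₀ ≤ d) :
    ∃ z, u₀ ≤ z ∧ z ≤ b ∧ (∀ u ∈ Ioo (0 : ℝ) 1, u ≤ z → lam * quantile F u ≤ d) ∧
      ∀ u ∈ Ioo (0 : ℝ) 1, z < u → u ≤ b → d < lam * quantile F u := by
  set S : Set ℝ := {u | u ∈ Ioo (0 : ℝ) 1 ∧ u ≤ b ∧ lam * quantile F u ≤ d}
  have hmem : u₀ ∈ S := ⟨hu₀, hb, hd⟩
  have hbdd : BddAbove S := ⟨b, fun u hu => hu.2.1⟩
  have hlt : ∀ u ∈ Ioo (0 : ℝ) 1, u < sSup S → lam * quantile F u ≤ d := fun u hu h => by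
    obtain ⟨v, hv, huv⟩ := exists_lt_of_lt_csSup ⟨u₀, hmem⟩ h
    exact (mul_le_mul_of_nonneg_left (monotoneOn_quantile F hu hv.1 huv.le) hl).trans hv.2.2
  refine ⟨sSup S, le_csSup hbdd hmem, csSup_le ⟨u₀, hmem⟩ fun u hu => hu.2.1, fun u hu h => ?_,
    fun u hu h hub => ?_⟩
  · rcases h.lt_or_eq with h | h
    · exact hlt u hu h
    · have ht : Tendsto (fun v => lam * quantile F v) (𝓝[<] u) (𝓝 (lam * quantile F u)) :=
        ((continuousWithinAt_quantile F hu).const_mul lam).mono_left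
          (nhdsWithin_mono _ Iio_subset_Iic_self)
      refine le_of_tendsto ht ?_
      filter_upwards [self_mem_nhdsWithin, nhdsWithin_le_nhds (Ioo_mem_nhds hu.1 hu.2)] with v h1 h2
      exact hlt v h2 (h ▸ h1)
  · by_contra hcon
    exact absurd (le_csSup hbdd (show u ∈ S from ⟨hu, hub, not_lt.1 hcon⟩)) (not_le.2 h)

/-- The integrand whose vanishing mean determines the value on the block. -/
noncomputable def blockExcess (F : Measure ℝ) (α β lam c u : ℝ) : ℝ :=
  (Ioc α β).indicator (fun u => max (1 / (β - α) + c - lam * quantile F u) 0) u -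
    (Iic α).indicator (fun u => max (lam * quantile F u - c) 0) u

theorem integrable_blockExcess (hF : Integrable (quantile F) unif) :
    Integrable (blockExcess F α β lam c) unif := by
  refine Integrable.sub (Integrable.indicator ?_ measurableSet_Ioc)
    (Integrable.indicator ?_ measurableSet_Iic)
  · exact ((integrable_const _).sub (hF.const_mul lam)).pos_part
  · exact ((hF.const_mul lam).sub (integrable_const _)).pos_part

theorem continuous_integral_blockExcess (hF : Integrable (quantile F) unif) :
    Continuous fun c => ∫ u, blockExcess F α β lam c u ∂unif := by
  refine (LipschitzWith.of_dist_le_mul (K := 1) fun c c' => ?_).continuous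
  rw [Real.dist_eq, Real.dist_eq, ← integral_sub (integrable_blockExcess hF)
    (integrable_blockExcess hF), ← Real.norm_eq_abs]
  refine (norm_integral_le_of_norm_le_const (C := |c - c'|)
    (Eventually.of_forall fun u => ?_)).trans_eq (by simp)
  unfold blockExcess indicator
  simp only [mem_Ioc, mem_Iic, Real.norm_eq_abs]
  by_cases h1 : u ≤ α
  · rw [if_neg (fun h => absurd h.1 (not_lt.2 h1)), if_pos h1, if_neg
      (fun h => absurd h.1 (not_lt.2 h1)), if_pos h1]
    have := abs_max_sub_max_le_abs (lam * quantile F u - c) (lam * quantile F u - c') 0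
    grind
  · rw [if_neg h1, if_neg h1]
    split_ifs
    · have := abs_max_sub_max_le_abs (1 / (β - α) + c - lam * quantile F u)
        (1 / (β - α) + c' - lam * quantile F u) 0
      grind
    · simp

theorem exists_isBlock (hF : Integrable (quantile F) unif) (hα : 0 < α) (hαβ : α < β)
    (hβ : β ≤ 1) (hl : 0 < lam) : ∃ z₀ z₁ c, IsBlock F α β lam z₀ z₁ c := by
  have hα1 : α ∈ Ioo (0 : ℝ) 1 := ⟨hα, by linarith⟩
  have hr : 0 < 1 / (β - α) := one_div_pos.2 (sub_pos.2 hαβ)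
  have hmono : ∀ u ∈ Ioo (0 : ℝ) 1, ∀ v ∈ Ioo (0 : ℝ) 1, u ≤ v →
    lam * quantile F u ≤ lam * quantile F v := fun u hu v hv h =>
      mul_le_mul_of_nonneg_left (monotoneOn_quantile F hu hv h) hl.le
  -- At the lower end the positive part on `(α, β]` vanishes, at the upper end the one on `(0, α]`.
  -- The resulting bounds on `c` also place the crossings on the correct sides of `α`.
  obtain ⟨c, hc, hc0⟩ := intermediate_value_Icc
    (by linarith : lam * quantile F α - 1 / (β - α) ≤ lam * quantile F α)
    (continuous_integral_blockExcess (α := α) (β := β) (lam := lam) hF).continuousOn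
    (show (0 : ℝ) ∈ Icc _ _ by
      constructor
      · refine integral_nonpos_of_ae (ae_unif fun u hu => ?_)
        unfold blockExcess indicator
        simp only [mem_Ioc, mem_Iic, Pi.zero_apply]
        have h1 : 0 ≤ max (lam * quantile F u - (lam * quantile F α - 1 / (β - α))) 0 :=
          le_max_right _ _
        split_ifs with ha hb hb
        · linarith [ha.1]
        · rw [max_eq_right (by linarith [hmono α hα1 u hu ha.1.le])]; simp
        · linarith
        · simp
      · refine integral_nonneg_of_ae (ae_unif fun u hu => ?_)
        unfold blockExcess indicator
        simp only [mem_Ioc, mem_Iic, Pi.zero_apply]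
        have h1 : 0 ≤ max (1 / (β - α) + lam * quantile F α - lam * quantile F u) 0 :=
          le_max_right _ _
        split_ifs with ha hb hb
        · linarith [ha.1]
        · linarith
        · rw [max_eq_right (by linarith [hmono u hu α hα1 hb])]; simp
        · simp)
  obtain ⟨z₀, h00, h0α, hz0, hz0', hend0, hpos0⟩ : ∃ z₀, 0 ≤ z₀ ∧ z₀ ≤ α ∧
      (∀ u ∈ Ioo (0 : ℝ) 1, u ≤ z₀ → lam * quantile F u ≤ c) ∧
      (∀ u ∈ Ioo (0 : ℝ) 1, z₀ < u → c ≤ lam * quantile F u) ∧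
      ((∀ u ∈ Ioo (0 : ℝ) 1, c ≤ lam * quantile F u) → z₀ = 0) ∧
      (¬ (∀ u ∈ Ioo (0 : ℝ) 1, c ≤ lam * quantile F u) → 0 < z₀) := by
    by_cases hall : ∀ u ∈ Ioo (0 : ℝ) 1, c ≤ lam * quantile F u
    · exact ⟨0, le_rfl, hα.le, fun u hu h => absurd hu.1 (not_lt.2 h), fun u hu _ => hall u hu,
        fun _ => rfl, fun h => absurd hall h⟩
    · have hall' := hall
      push Not at hall'
      obtain ⟨u₀, hu₀, h⟩ := hall'
      have huα : u₀ ≤ α := by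
        by_contra hcon
        linarith [hmono α hα1 u₀ hu₀ (not_le.1 hcon).le, hc.2]
      obtain ⟨z, h1, h2, h3, h4⟩ := exists_level hl.le hu₀ huα h.le
      refine ⟨z, hu₀.1.le.trans h1, h2, h3, fun u hu hz => ?_, fun h => absurd h hall,
        fun _ => hu₀.1.trans_le h1⟩
      rcases le_total u α with h' | h'
      · exact (h4 u hu hz h').le
      · exact hc.2.trans (hmono α hα1 u hu h')
  obtain ⟨z₁, h1α, h1β, hz1, hz1', hend1, hpos1⟩ : ∃ z₁, α ≤ z₁ ∧ z₁ ≤ β ∧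
      (∀ u ∈ Ioo (0 : ℝ) 1, u ≤ z₁ → lam * quantile F u ≤ c + 1 / (β - α)) ∧
      (∀ u ∈ Ioo (0 : ℝ) 1, z₁ < u → u ≤ β → c + 1 / (β - α) ≤ lam * quantile F u) ∧
      ((∀ u ∈ Ioo (0 : ℝ) 1, u ≤ β → lam * quantile F u ≤ c + 1 / (β - α)) → z₁ = β) ∧
      (¬ (∀ u ∈ Ioo (0 : ℝ) 1, u ≤ β → lam * quantile F u ≤ c + 1 / (β - α)) → z₁ < β) := by
    by_cases hall : ∀ u ∈ Ioo (0 : ℝ) 1, u ≤ β → lam * quantile F u ≤ c + 1 / (β - α)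
    · exact ⟨β, hαβ.le, le_rfl, hall, fun u hu h h' => absurd h (not_lt.2 h'), fun _ => rfl,
        fun h => absurd hall h⟩
    · obtain ⟨z, h1, h2, h3, h4⟩ := exists_level hl.le hα1 hαβ.le
        (by linarith [hc.1] : lam * quantile F α ≤ c + 1 / (β - α))
      refine ⟨z, h1, h2, h3, fun u hu hz hu' => (h4 u hu hz hu').le, fun h => absurd h hall,
        fun _ => h2.lt_of_ne fun hz => hall ?_⟩
      rwa [hz] at h3
  -- The two positive parts in `blockExcess` vanish off `(z₀, z₁]` and add up to the residual on it.
  have haverage : (z₁ - α) * (1 / (β - α)) + c * (z₁ - z₀) -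
      lam * ∫ u in z₀..z₁, quantile F u = 0 := by
    rw [← integral_block hF h00 h0α h1α h1β hβ, ← hc0]
    refine integral_congr_ae (ae_unif fun u hu => ?_)
    have b0 := hz0 u hu
    have b1 := hz0' u hu
    have b2 := hz1 u hu
    have b3 := hz1' u hu
    simp only [blockExcess, rvarWeight, indicator, mem_Ioc, mem_Iic]
    by_cases hu' : u ≤ α
    · have e1 : ¬ (α < u ∧ u ≤ β) := fun h => absurd h.1 (not_lt.2 hu')
      rw [if_neg e1, if_neg e1, if_pos hu']
      by_cases h : z₀ < u
      · rw [if_pos ⟨h, hu'.trans h1α⟩, max_eq_left (by linarith [b1 h])]; ring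
      · rw [if_neg (fun h' => h h'.1), max_eq_right (by linarith [b0 (not_lt.1 h)])]; ring
    · rw [if_neg hu']
      by_cases h : u ≤ z₁
      · rw [if_pos ⟨h0α.trans_lt (not_le.1 hu'), h⟩, if_pos ⟨not_le.1 hu', h.trans h1β⟩,
          if_pos ⟨not_le.1 hu', h.trans h1β⟩, max_eq_left (by linarith [b2 h])]; ring
      · rw [if_neg (fun h' => h h'.2)]
        split_ifs with h'
        · rw [max_eq_right (by linarith [b3 (not_le.1 h) h'.2])]; ring
        · ring
  refine ⟨z₀, z₁, c, h00, h0α, h1α, h1β,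
    fun h => hend0 ((le_mul_quantileExt_zero F hl.le).1 h), fun h => ?_, fun h => ?_,
    fun h => hend1 ((mul_quantileExt_sub_le F hl.le (hα.trans hαβ) hβ).1 h), fun hlt => ?_⟩
  · rw [← not_le, le_mul_quantileExt_zero F hl.le] at h
    have hz : z₀ ∈ Ioo (0 : ℝ) 1 := ⟨hpos0 h, by linarith⟩
    refine ⟨hpos0 h, hz0 z₀ hz le_rfl, ?_⟩
    rw [← div_le_iff₀' hl]
    exact le_quantileRight F hz fun u hu hzu => (div_le_iff₀' hl).2 (hz0' u hu hzu)
  · rw [← not_le, mul_quantileExt_sub_le F hl.le (hα.trans hαβ) hβ] at h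
    have hz : z₁ ∈ Ioo (0 : ℝ) 1 := ⟨by linarith, by linarith [hpos1 h]⟩
    refine ⟨hpos1 h, hz1 z₁ hz le_rfl, ?_⟩
    rw [← div_le_iff₀' hl]
    refine le_quantileRight F hz fun u hu hzu => (div_le_iff₀' hl).2 ?_
    -- The bound is known only up to `β`; monotonicity carries it beyond.
    by_cases hzβ : u ≤ β
    · exact hz1' u hu hzu hzβ
    · have hβ1 : β ∈ Ioo (0 : ℝ) 1 := ⟨by linarith, by linarith [hu.2]⟩
      exact (hz1' β hβ1 (hpos1 h) le_rfl).trans (hmono β hβ1 u hu (not_le.1 hzβ).le)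
  · have h1 : z₁ - z₀ ≠ 0 := (sub_pos.2 hlt).ne'
    have h2 : β - α ≠ 0 := (sub_pos.2 hαβ).ne'
    generalize (∫ u in z₀..z₁, quantile F u) = I at haverage ⊢
    field_simp at haverage ⊢
    linarith

/-- A block that covers `(0, β]`. -/
theorem isBlock_full (hα : 0 < α) (hαβ : α < β) (hβ : β ≤ 1) (hl : 0 ≤ lam)
    (h0 : ∀ u ∈ Ioo (0 : ℝ) 1, c ≤ lam * quantile F u)
    (h1 : ∀ u ∈ Ioo (0 : ℝ) 1, u ≤ β → lam * quantile F u ≤ c + 1 / (β - α))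
    (ha : c = -1 / β + lam / β * ∫ u in 0..β, quantile F u) :
    IsBlock F α β lam 0 β c := by
  have h0' := (le_mul_quantileExt_zero F hl).2 h0
  have h1' := (mul_quantileExt_sub_le F (c := c) hl (hα.trans hαβ) hβ).2 h1
  refine ⟨le_rfl, hα.le, hαβ.le, le_rfl, fun _ => rfl, fun h => absurd h0' (not_le.2 h),
    fun h => absurd h1' (not_le.2 h), fun _ => rfl, fun _ => ?_⟩
  have h2 : β - α ≠ 0 := (sub_pos.2 hαβ).ne'
  have h3 : β ≠ 0 := (hα.trans hαβ).ne'
  rw [ha]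
  generalize (∫ u in 0..β, quantile F u) = I
  field_simp
  ring

theorem IsBlock.blockEquations (hα : 0 < α) (hαβ : α < β) (hβ : β ≤ 1)
    (hc : ContinuousOn (quantile F) (Ioo 0 1)) (h : IsBlock F α β lam z₀ z₁ c) :
    BlockEquations F α β lam z₀ z₁ c := by
  have hr : 0 < 1 / (β - α) := one_div_pos.2 (sub_pos.2 hαβ)
  have ext : ∀ {u : ℝ}, u ∈ Ioo (0 : ℝ) 1 → ((lam : ℝ) : EReal) * quantileExt F u =
      ((lam * quantile F u : ℝ) : EReal) := fun hu => by
    rw [quantileExt, if_neg (not_le.2 hu.1), if_neg (not_le.2 hu.2), EReal.coe_mul]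
  have hz1 : 0 < z₁ := hα.trans_le h.alpha_le
  have left : lam * quantileExt F 0 < (c : EReal) → z₀ ∈ Ioo (0 : ℝ) 1 ∧
      lam * quantile F z₀ = c := fun h' => by
    obtain ⟨h0, h1, h2⟩ := h.left_cross h'
    have hz : z₀ ∈ Ioo (0 : ℝ) 1 := ⟨h0, by linarith [h.le_alpha]⟩
    rw [quantileRight_eq F hc hz] at h2
    exact ⟨hz, le_antisymm h1 h2⟩
  have right : ((1 / (β - α) : ℝ) : EReal) < lam * quantileExt F β - c → z₁ ∈ Ioo (0 : ℝ) 1 ∧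
      lam * quantile F z₁ = c + 1 / (β - α) := fun h' => by
    obtain ⟨h0, h1, h2⟩ := h.right_cross h'
    have hz : z₁ ∈ Ioo (0 : ℝ) 1 := ⟨hz1, by linarith⟩
    rw [quantileRight_eq F hc hz] at h2
    exact ⟨hz, le_antisymm h1 h2⟩
  -- An empty block would sit at `α`, strictly between `0` and `β`, so both crossing conditions
  -- would apply; by continuity `lam F⁻¹(α)` would equal both `c` and `c + 1 / (β - α)`.
  have hlt : z₀ < z₁ := by
    refine (h.le_alpha.trans h.alpha_le).lt_of_ne fun he => ?_
    have h0 : lam * quantileExt F 0 < (c : EReal) := by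
      rw [← not_le]
      exact fun h' => absurd (h.left_end h') (by linarith)
    have h1 : ((1 / (β - α) : ℝ) : EReal) < lam * quantileExt F β - c := by
      rw [← not_le]
      exact fun h' => absurd (h.right_end h') (by linarith [h.le_alpha])
    have e0 := (left h0).2
    have e1 := (right h1).2
    rw [he] at e0
    linarith
  refine ⟨hlt, fun h' => ?_, fun h1 h2 => ?_, fun h' => by rw [h.right_end h'],
    fun h' => by rw [h.left_end h'], fun h' => ?_, h.average hlt⟩
  · rw [ext (right h').1, (right h').2]
  · rw [ext (right h1).1, (right h1).2, EReal.coe_add]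
    congr 1
    rcases h2.lt_or_eq with h2 | h2
    · rw [ext (left h2).1, (left h2).2]
    · rw [h.left_end h2.ge, h2]
  · rw [ext (left h').1, (left h').2]

end Block

/-! ### Standardisation in a Hilbert space -/

section Hilbert

open RealInnerProductSpace

variable {E : Type*} [NormedAddCommGroup E] [InnerProductSpace ℝ E]

/-- The component of `x` orthogonal to the unit vector `e`. -/
def centered (e x : E) : E := x - ⟪e, x⟫ • e

/-- The vector with mean `μ` and standard deviation `σ` in the direction of `g`. -/
noncomputable def rescaled (e : E) (μ σ : ℝ) (g : E) : E :=
  μ • e + (σ / ‖centered e g‖) • centered e g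

variable {e : E} {μ σ : ℝ}

theorem inner_centered (x y : E) :
    ⟪x, centered e y⟫ = ⟪x, y⟫ - ⟪e, x⟫ * ⟪e, y⟫ := by
  rw [centered, inner_sub_right, inner_smul_right, real_inner_comm e x]
  ring

theorem inner_e_centered (he : ‖e‖ = 1) (y : E) : ⟪e, centered e y⟫ = 0 := by
  rw [inner_centered, real_inner_self_eq_norm_sq, he]
  ring

theorem inner_centered_centered (he : ‖e‖ = 1) (x y : E) :
    ⟪centered e x, centered e y⟫ = ⟪x, centered e y⟫ := by
  rw [centered, inner_sub_left, inner_smul_left, inner_e_centered he]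
  simp

theorem norm_centered_sq (he : ‖e‖ = 1) (x : E) : ‖centered e x‖ ^ 2 = ⟪x, x⟫ - ⟪e, x⟫ ^ 2 := by
  rw [← real_inner_self_eq_norm_sq, inner_centered_centered he, inner_centered]
  ring

theorem centered_smul_add (he : ‖e‖ = 1) (p q : ℝ) (x : E) :
    centered e (p • e + q • x) = q • centered e x := by
  simp only [centered, inner_add_right, inner_smul_right, real_inner_self_eq_norm_sq, he]
  module

/-- Rescaling forgets increasing affine changes. This permits dividing by the multiplier at infinity
and comparing projections that are affine images of each other. -/
theorem rescaled_smul_add (he : ‖e‖ = 1) (p : ℝ) {q : ℝ} (hq : 0 < q) (x : E) :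
    rescaled e μ σ (p • e + q • x) = rescaled e μ σ x := by
  rw [rescaled, rescaled, centered_smul_add he, norm_smul, Real.norm_of_nonneg hq.le, smul_smul]
  congr 2
  field_simp

theorem rescaled_smul (he : ‖e‖ = 1) {q : ℝ} (hq : 0 < q) (x : E) :
    rescaled e μ σ (q • x) = rescaled e μ σ x := by
  simpa using rescaled_smul_add (μ := μ) (σ := σ) he 0 hq x

theorem inner_e_rescaled (he : ‖e‖ = 1) (g : E) : ⟪e, rescaled e μ σ g⟫ = μ := by
  rw [rescaled, inner_add_right, inner_smul_right, inner_smul_right, inner_e_centered he,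
    real_inner_self_eq_norm_sq, he]
  ring

theorem centered_centered (he : ‖e‖ = 1) (g : E) : centered e (centered e g) = centered e g := by
  rw [centered, inner_e_centered he, zero_smul, sub_zero]

theorem centered_rescaled (he : ‖e‖ = 1) (g : E) :
    centered e (rescaled e μ σ g) = (σ / ‖centered e g‖) • centered e g := by
  rw [rescaled, centered_smul_add he, centered_centered he]

theorem norm_centered_rescaled (he : ‖e‖ = 1) (hσ : 0 < σ) {g : E} (hg : centered e g ≠ 0) :
    ‖centered e (rescaled e μ σ g)‖ = σ := by
  have := norm_pos_iff.2 hg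
  rw [centered_rescaled he, norm_smul, Real.norm_of_nonneg (by positivity)]
  field_simp

/-- `g` as a combination of `e` and its rescaling. -/
theorem eq_rescaled (hσ : 0 < σ) {g : E} (hg : centered e g ≠ 0) :
    g = (⟪e, g⟫ - ‖centered e g‖ / σ * μ) • e + (‖centered e g‖ / σ) • rescaled e μ σ g := by
  have h1 := (norm_pos_iff.2 hg).ne'
  rw [rescaled, smul_add, smul_smul, smul_smul,
    show ‖centered e g‖ / σ * (σ / ‖centered e g‖) = 1 by field_simp]
  simp only [centered]
  module

/-- The rescaled projection maximises `ψ` among the vectors with the same mean and standard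
deviation, with a quantitative uniqueness. -/
theorem inner_add_le_inner_rescaled (he : ‖e‖ = 1) (hσ : 0 < σ) {ψ g x : E}
    (hg : centered e g ≠ 0) (h1 : ⟪ψ - g, x⟫ ≤ 0) (h2 : ⟪ψ - g, e⟫ = 0) (h3 : ⟪ψ - g, g⟫ = 0)
    (hx : ⟪e, x⟫ = μ) (hx' : ‖centered e x‖ = σ) :
    ⟪ψ, x⟫ + ‖centered e g‖ / (2 * σ) * ‖x - rescaled e μ σ g‖ ^ 2 ≤ ⟪ψ, rescaled e μ σ g⟫ := by
  have hpos := norm_pos_iff.2 hg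
  have e1 : ⟪ψ - g, rescaled e μ σ g⟫ = 0 := by
    have : ⟪ψ - g, centered e g⟫ = 0 := by
      rw [centered, inner_sub_right, inner_smul_right, h2, h3]; ring
    rw [rescaled, inner_add_right, inner_smul_right, inner_smul_right, h2, this]; ring
  rw [inner_sub_left] at h1 e1
  have e2 : ⟪g, rescaled e μ σ g⟫ = ⟪e, g⟫ * μ + σ * ‖centered e g‖ := by
    rw [rescaled, inner_add_right, inner_smul_right, inner_smul_right, ← inner_centered_centered he,
      real_inner_self_eq_norm_sq, real_inner_comm]
    field_simp
  have e3 : ⟪g, x⟫ = ⟪e, g⟫ * μ + ⟪centered e x, centered e g⟫ := by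
    rw [inner_centered_centered he, inner_centered, hx, real_inner_comm x g]; ring
  have e4 : x - rescaled e μ σ g = centered e x - (σ / ‖centered e g‖) • centered e g := by
    rw [rescaled]
    conv_rhs => rw [centered, hx]
    abel
  -- Both centred vectors have norm `σ`, so the deficit in Cauchy–Schwarz is exactly a multiple of
  -- their squared distance.
  have e5 : ‖x - rescaled e μ σ g‖ ^ 2 =
      2 * σ ^ 2 - 2 * (σ / ‖centered e g‖) * ⟪centered e x, centered e g⟫ := by
    rw [e4, norm_sub_sq_real, norm_smul, inner_smul_right, hx',
      Real.norm_of_nonneg (by positivity)]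
    field_simp
    ring
  have e6 : ‖centered e g‖ / (2 * σ) * ‖x - rescaled e μ σ g‖ ^ 2 =
      σ * ‖centered e g‖ - ⟪centered e x, centered e g⟫ := by
    rw [e5]; field_simp
  linarith

theorem continuous_centered : Continuous (centered e) := by
  unfold centered
  fun_prop

theorem continuousAt_rescaled {g : E} (hg : centered e g ≠ 0) :
    ContinuousAt (rescaled e μ σ) g := by
  have h := (continuous_centered (e := e)).continuousAt (x := g)
  exact continuousAt_const.add ((continuousAt_const.div h.norm (norm_ne_zero_iff.2 hg)).smul h)

/-- A family of projections of `l • Q - γ`, `l ≥ 0`, onto a cone that contains `Q` and `± e`. -/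
structure IsProjectionFamily (e Q γ : E) (g : ℝ → E) : Prop where
  le : ∀ l, 0 ≤ l → ∀ l', 0 ≤ l' → ⟪l • Q - γ - g l, g l'⟫ ≤ 0
  eq : ∀ l, 0 ≤ l → ⟪l • Q - γ - g l, g l⟫ = 0
  le_Q : ∀ l, 0 ≤ l → ⟪l • Q - γ - g l, Q⟫ ≤ 0
  eq_e : ∀ l, 0 ≤ l → ⟪l • Q - γ - g l, e⟫ = 0
  ne : ∀ l, 0 < l → centered e (g l) ≠ 0

variable {Q γ : E} {g : ℝ → E}

/-- Nonexpansiveness of projections: each residual is tested against the other member, and the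
inequalities are added. -/
theorem IsProjectionFamily.norm_sub_le (h : IsProjectionFamily e Q γ g) {l l' : ℝ} (hl : 0 ≤ l)
    (hl' : 0 ≤ l') : ‖g l - g l'‖ ≤ |l - l'| * ‖Q‖ := by
  have h1 := h.le l hl l' hl'
  have h2 := h.le l' hl' l hl
  have h3 := h.eq l hl
  have h4 := h.eq l' hl'
  have h5 : ‖g l - g l'‖ ^ 2 ≤ (l - l') * ⟪Q, g l - g l'⟫ := by
    rw [← real_inner_self_eq_norm_sq]
    simp only [inner_sub_left, inner_sub_right, inner_smul_left, RCLike.conj_to_real]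
      at h1 h2 h3 h4 ⊢
    nlinarith
  have h6 : (l - l') * ⟪Q, g l - g l'⟫ ≤ |l - l'| * (‖Q‖ * ‖g l - g l'‖) := by
    refine (le_abs_self _).trans ?_
    rw [abs_mul]
    exact mul_le_mul_of_nonneg_left (abs_real_inner_le_norm _ _) (abs_nonneg _)
  by_contra hcon
  have hpos : 0 < ‖g l - g l'‖ := lt_of_le_of_lt (by positivity) (not_le.1 hcon)
  nlinarith [not_le.1 hcon]

/-- Since `l • Q` lies in the cone it is its own projection, and the projected point was moved only
by `γ`. -/
theorem IsProjectionFamily.norm_sub_smul_le (h : IsProjectionFamily e Q γ g) {l : ℝ}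
    (hl : 0 ≤ l) : ‖g l - l • Q‖ ≤ ‖γ‖ := by
  have h1 := h.le_Q l hl
  have h2 := h.eq l hl
  have h5 : ‖g l - l • Q‖ ^ 2 ≤ -⟪γ, g l - l • Q⟫ := by
    rw [← real_inner_self_eq_norm_sq]
    simp only [inner_sub_left, inner_sub_right, inner_smul_left, inner_smul_right,
      RCLike.conj_to_real] at h1 h2 ⊢
    rw [real_inner_comm Q (g l)] at h1
    rw [real_inner_comm Q (g l)]
    have := mul_le_mul_of_nonneg_left h1 hl
    linarith
  have h6 := (neg_le_abs _).trans (abs_real_inner_le_norm γ (g l - l • Q))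
  by_contra hcon
  have hpos : 0 < ‖g l - l • Q‖ := lt_of_le_of_lt (norm_nonneg _) (not_le.1 hcon)
  nlinarith [not_le.1 hcon]

theorem IsProjectionFamily.continuousOn (h : IsProjectionFamily e Q γ g) :
    ContinuousOn g (Ioi 0) := by
  refine (LipschitzOnWith.of_dist_le_mul (K := ‖Q‖₊) fun l hl l' hl' => ?_).continuousOn
  rw [dist_eq_norm, Real.dist_eq, mul_comm]
  exact h.norm_sub_le (le_of_lt hl) (le_of_lt hl')

theorem IsProjectionFamily.continuousOn_rescaled (h : IsProjectionFamily e Q γ g) :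
    ContinuousOn (fun l => ⟪Q, rescaled e μ σ (g l)⟫) (Ioi 0) := by
  intro l hl
  exact continuousWithinAt_const.inner (𝕜 := ℝ)
    ((continuousAt_rescaled (h.ne l hl)).comp_continuousWithinAt (h.continuousOn l hl))

theorem IsProjectionFamily.tendsto_rescaled (he : ‖e‖ = 1) (h : IsProjectionFamily e Q γ g)
    (hQ : centered e Q ≠ 0) :
    Tendsto (fun l => ⟪Q, rescaled e μ σ (g l)⟫) atTop (𝓝 (μ * ⟪e, Q⟫ + σ * ‖centered e Q‖)) := by
  have h1 : Tendsto (fun l : ℝ => l⁻¹ • g l) atTop (𝓝 Q) := by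
    rw [tendsto_iff_norm_sub_tendsto_zero]
    refine squeeze_zero' (Eventually.of_forall fun _ => norm_nonneg _) ?_
      (by simpa using tendsto_inv_atTop_zero.mul_const ‖γ‖)
    filter_upwards [eventually_gt_atTop 0] with l hl
    rw [show l⁻¹ • g l - Q = l⁻¹ • (g l - l • Q) by
      rw [smul_sub, smul_smul, inv_mul_cancel₀ hl.ne', one_smul], norm_smul,
      Real.norm_of_nonneg (inv_nonneg.2 hl.le)]
    exact mul_le_mul_of_nonneg_left (h.norm_sub_smul_le hl.le) (inv_nonneg.2 hl.le)
  have h2 := ((continuousAt_rescaled (μ := μ) (σ := σ) hQ).tendsto.comp h1)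
  have h3 : ⟪Q, rescaled e μ σ Q⟫ = μ * ⟪e, Q⟫ + σ * ‖centered e Q‖ := by
    have := norm_ne_zero_iff.2 hQ
    rw [rescaled, inner_add_right, inner_smul_right, inner_smul_right,
      ← inner_centered_centered he, real_inner_self_eq_norm_sq, real_inner_comm e Q]
    field_simp
  rw [← h3]
  refine (tendsto_const_nhds.inner h2).congr' ?_
  filter_upwards [eventually_gt_atTop 0] with l hl
  rw [Function.comp_apply, rescaled_smul he (inv_pos.2 hl)]

theorem IsProjectionFamily.exists_eq (he : ‖e‖ = 1) (h : IsProjectionFamily e Q γ g)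
    (hQ : centered e Q ≠ 0) {t₀ t : ℝ}
    (h0 : Tendsto (fun l => ⟪Q, rescaled e μ σ (g l)⟫) (𝓝[>] 0) (𝓝 t₀)) (ht₀ : t₀ < t)
    (ht : t < μ * ⟪e, Q⟫ + σ * ‖centered e Q‖) :
    ∃ l > 0, ⟪Q, rescaled e μ σ (g l)⟫ = t := by
  obtain ⟨l₁, h1, h1'⟩ := ((h0.eventually (eventually_lt_nhds ht₀)).and
    self_mem_nhdsWithin).exists
  obtain ⟨l₂, h2, h2'⟩ := (((h.tendsto_rescaled (μ := μ) (σ := σ) he hQ).eventually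
    (eventually_gt_nhds ht)).and (eventually_gt_atTop 0)).exists
  obtain ⟨l, hl, hlt⟩ := isPreconnected_Ioi.intermediate_value h1' h2'
    h.continuousOn_rescaled ⟨h1.le, h2.le⟩
  exact ⟨l, hl, hlt⟩

theorem IsProjectionFamily.inner_rescaled_le (hσ : 0 < σ) (h : IsProjectionFamily e Q γ g)
    {l l' : ℝ} (hl : 0 ≤ l) (hl' : 0 ≤ l') :
    ⟪l • Q - γ - g l, rescaled e μ σ (g l')⟫ ≤ 0 := by
  rw [rescaled, centered, inner_add_right, inner_smul_right, inner_smul_right, inner_sub_right,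
    inner_smul_right, h.eq_e l hl]
  have := h.le l hl l' hl'
  have : 0 ≤ σ / ‖g l' - ⟪e, g l'⟫ • e‖ := by positivity
  nlinarith

/-- Two members of the family whose rescalings have the same inner product with `Q` have the
same rescaling. -/
theorem IsProjectionFamily.rescaled_eq (he : ‖e‖ = 1) (hσ : 0 < σ)
    (h : IsProjectionFamily e Q γ g) {l l' : ℝ} (hl : 0 < l) (hl' : 0 < l')
    (heq : ⟪Q, rescaled e μ σ (g l)⟫ = ⟪Q, rescaled e μ σ (g l')⟫) :
    rescaled e μ σ (g l) = rescaled e μ σ (g l') := by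
  have key := fun (l : ℝ) (hl : 0 < l) l' (hl' : 0 < l') => inner_add_le_inner_rescaled he hσ
    (h.ne l hl) (h.inner_rescaled_le (μ := μ) hσ hl.le hl'.le) (h.eq_e l hl.le) (h.eq l hl.le)
    (inner_e_rescaled he _)
    (norm_centered_rescaled he hσ (h.ne l' hl'))
  have k1 := key l hl l' hl'
  have k2 := key l' hl' l hl
  have hp := norm_pos_iff.2 (h.ne l hl)
  have hp' := norm_pos_iff.2 (h.ne l' hl')
  simp only [inner_sub_left, inner_smul_left, RCLike.conj_to_real] at k1 k2
  -- The terms in `Q` now agree, so `k1` and `k2` compare the same two values of `γ` in opposite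
  -- directions; their sum leaves no room for the squares.
  rw [heq] at k1 k2
  have n1 : 0 ≤ ‖centered e (g l)‖ / (2 * σ) *
    ‖rescaled e μ σ (g l') - rescaled e μ σ (g l)‖ ^ 2 := by positivity
  have n2 : 0 ≤ ‖centered e (g l')‖ / (2 * σ) *
    ‖rescaled e μ σ (g l) - rescaled e μ σ (g l')‖ ^ 2 := by positivity
  have n3 : ‖centered e (g l')‖ / (2 * σ) *
    ‖rescaled e μ σ (g l) - rescaled e μ σ (g l')‖ ^ 2 = 0 := by linarith
  rcases mul_eq_zero.1 n3 with h0 | h0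
  · exact absurd h0 (by positivity)
  · exact sub_eq_zero.1 (norm_eq_zero.1 (pow_eq_zero_iff two_ne_zero |>.1 h0))

/-- If one member is an increasing affine image of the member at `0`, so are all before it. -/
theorem IsProjectionFamily.rescaled_eq_zero (he : ‖e‖ = 1) (h : IsProjectionFamily e Q γ g)
    {l₁ p q : ℝ} (hl₁ : 0 < l₁) (hq : 0 < q) (hg : g l₁ = p • e + q • g 0) {l : ℝ} (hl : 0 ≤ l)
    (hll : l ≤ l₁) : rescaled e μ σ (g l) = rescaled e μ σ (g 0) := by
  obtain ⟨θ, hθ, hθ1, rfl⟩ : ∃ θ : ℝ, 0 ≤ θ ∧ θ ≤ 1 ∧ l = θ * l₁ :=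
    ⟨l / l₁, by positivity, (div_le_one hl₁).2 hll, by field_simp⟩
  have hg0 : ⟪l₁ • Q - γ - g l₁, g 0⟫ = 0 := by
    have h1 := h.eq l₁ hl₁.le
    have h2 := h.eq_e l₁ hl₁.le
    nth_rw 2 [hg] at h1
    rw [inner_add_right, inner_smul_right, inner_smul_right, h2, mul_zero, zero_add] at h1
    exact (mul_eq_zero.1 h1).resolve_left hq.ne'
  -- The residuals at `0` and `l₁` are orthogonal to both `g 0` and `g l₁`, so the interpolated
  -- point satisfies the relations that characterise the projection at `θ * l₁`.
  set x : E := θ • g l₁ + (1 - θ) • g 0 with hx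
  have hψ : (θ * l₁) • Q - γ - x =
      θ • (l₁ • Q - γ - g l₁) + (1 - θ) • ((0 : ℝ) • Q - γ - g 0) := by
    rw [hx]; module
  have h1 : ⟪(θ * l₁) • Q - γ - g (θ * l₁), x⟫ ≤ 0 := by
    rw [hx, inner_add_right, inner_smul_right, inner_smul_right]
    have := mul_nonpos_of_nonneg_of_nonpos hθ (h.le _ hl l₁ hl₁.le)
    have := mul_nonpos_of_nonneg_of_nonpos (sub_nonneg.2 hθ1) (h.le _ hl 0 le_rfl)
    linarith
  have h2 := h.eq _ hl
  have h3 : ⟪(θ * l₁) • Q - γ - x, g (θ * l₁)⟫ ≤ 0 := by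
    rw [hψ, inner_add_left, inner_smul_left, inner_smul_left]
    have := mul_nonpos_of_nonneg_of_nonpos hθ (h.le l₁ hl₁.le _ hl)
    have := mul_nonpos_of_nonneg_of_nonpos (sub_nonneg.2 hθ1) (h.le 0 le_rfl _ hl)
    simp only [RCLike.conj_to_real]
    linarith
  have h4 : ⟪(θ * l₁) • Q - γ - x, x⟫ = 0 := by
    rw [hψ, inner_add_left, inner_smul_left, inner_smul_left, hx, inner_add_right,
      inner_add_right, inner_smul_right, inner_smul_right, inner_smul_right, inner_smul_right,
      h.eq l₁ hl₁.le, hg0, h.eq 0 le_rfl]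
    have : ⟪(0 : ℝ) • Q - γ - g 0, g l₁⟫ = 0 := by
      rw [hg, inner_add_right, inner_smul_right, inner_smul_right, h.eq_e 0 le_rfl,
        h.eq 0 le_rfl]
      ring
    rw [this]
    ring
  have h5 : g (θ * l₁) = x := by
    have : ‖g (θ * l₁) - x‖ ^ 2 ≤ 0 := by
      rw [← real_inner_self_eq_norm_sq, inner_sub_right]
      have e1 : ∀ y, ⟪g (θ * l₁) - x, y⟫ =
          ⟪(θ * l₁) • Q - γ - x, y⟫ - ⟪(θ * l₁) • Q - γ - g (θ * l₁), y⟫ := fun y => by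
        rw [← inner_sub_left]; congr 1; abel
      rw [e1, e1]
      linarith
    exact sub_eq_zero.1 (norm_eq_zero.1 (pow_eq_zero_iff two_ne_zero |>.1
      (le_antisymm this (sq_nonneg _))))
  rw [h5, hx, hg, show θ • (p • e + q • g 0) + (1 - θ) • g 0 =
    (θ * p) • e + (θ * q + (1 - θ)) • g 0 by module]
  refine rescaled_smul_add he _ ?_ _
  rcases hθ1.lt_or_eq with h' | h'
  · have := mul_nonneg hθ hq.le
    linarith
  · rw [h']; linarith

/-- If two members are increasing affine images of `y`, and `d • e - y` and `g 0` are related as a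
function supported in `(0, β]` and a multiple of the indicator of `(0, β]`, then the family is
constant before them up to rescaling. -/
theorem IsProjectionFamily.rescaled_eq_of_collapse (he : ‖e‖ = 1) (hσ : 0 < σ)
    (h : IsProjectionFamily e Q γ g) (hγ : ⟪γ, e⟫ = 1) {l₁ l₂ : ℝ} (hl₁ : 0 < l₁) (hl : l₁ < l₂)
    {y : E} (h1 : rescaled e μ σ (g l₁) = y) {p₁ q₁ p₂ q₂ d β : ℝ} (hq₁ : 0 < q₁) (hq₂ : 0 < q₂)
    (hg₁ : g l₁ = p₁ • e + q₁ • y) (hg₂ : g l₂ = p₂ • e + q₂ • y)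
    (hd : (l₂ * p₁ - l₁ * p₂) + (l₂ * q₁ - l₁ * q₂) * d = 0)
    (hd0 : 0 ≤ ⟪e, d • e - y⟫) (h0 : ⟪g 0, g 0⟫ = 1 / β)
    (h0' : ⟪g 0, d • e - y⟫ = -(1 / β) * ⟪e, d • e - y⟫) {l : ℝ} (hl0 : 0 < l) (hll : l ≤ l₁) :
    rescaled e μ σ (g l) = y := by
  have hl₂ := hl₁.trans hl
  set R := l₂ * q₁ - l₁ * q₂ with hR
  set P := l₂ * p₁ - l₁ * p₂ with hP
  set H := d • e - y with hH
  set m := ⟪e, H⟫ with hm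
  -- This combination of residuals eliminates `Q`. Pairing it with `e` gives `R * m = l₂ - l₁`,
  -- whence `m, R > 0`; pairing it with `H` gives `R * ⟪H, H⟫ = (l₂ - l₁) * ⟪γ, H⟫`.
  have hN : l₂ • (l₁ • Q - γ - g l₁) - l₁ • (l₂ • Q - γ - g l₂) =
      -((l₂ - l₁) • γ) + R • H := by
    have hP' : P = -R * d := by linarith
    have e1 : l₂ • g l₁ - l₁ • g l₂ = P • e + R • y := by
      rw [hg₁, hg₂, hP, hR]; module
    have e2 : l₂ • (l₁ • Q - γ - g l₁) - l₁ • (l₂ • Q - γ - g l₂) =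
      -((l₂ - l₁) • γ) - (l₂ • g l₁ - l₁ • g l₂) := by module
    rw [e2, e1, hP', hH]
    module
  have orth : ∀ {l p q : ℝ}, 0 ≤ l → 0 < q → g l = p • e + q • y →
      ⟪l • Q - γ - g l, y⟫ = 0 := fun {l p q} hl hq hg => by
    have a1 := h.eq l hl
    nth_rw 2 [hg] at a1
    rw [inner_add_right, inner_smul_right, inner_smul_right, h.eq_e l hl, mul_zero,
      zero_add] at a1
    exact (mul_eq_zero.1 a1).resolve_left hq.ne'
  have hNe : -((l₂ - l₁) * 1) + R * m = 0 := by
    have := congrArg (fun v => ⟪v, e⟫) hN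
    rw [inner_sub_left, inner_smul_left, inner_smul_left, h.eq_e _ hl₁.le, h.eq_e _ hl₂.le,
      inner_add_left, inner_neg_left, inner_smul_left, inner_smul_left, hγ,
      real_inner_comm e H] at this
    simpa using this.symm
  have hNH : -((l₂ - l₁) * ⟪γ, H⟫) + R * ⟪H, H⟫ = 0 := by
    have := congrArg (fun v => ⟪v, H⟫) hN
    have a1 : ∀ {l p q : ℝ}, 0 ≤ l → 0 < q → g l = p • e + q • y →
        ⟪l • Q - γ - g l, H⟫ = 0 := fun hl hq hg => by
      rw [hH, inner_sub_right, inner_smul_right, orth hl hq hg, h.eq_e _ hl]; ring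
    rw [inner_sub_left, inner_smul_left, inner_smul_left, a1 hl₁.le hq₁ hg₁, a1 hl₂.le hq₂ hg₂,
      inner_add_left, inner_neg_left, inner_smul_left, inner_smul_left] at this
    simpa using this.symm
  have hm0 : 0 < m := hd0.lt_of_ne fun h' => by
    rw [← h'] at hNe
    linarith
  have hR0 : 0 < R := by
    by_contra hcon
    nlinarith [not_lt.1 hcon]
  -- The residual `-γ - g 0` at `l = 0` is orthogonal to `e` and nonpositive on `y`, hence
  -- nonnegative on `H`.
  have hγH : ⟪γ, H⟫ ≤ 1 / β * m := by
    have a1 := h.inner_rescaled_le (μ := μ) hσ le_rfl hl₁.le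
    rw [h1] at a1
    have a2 := h.eq_e 0 le_rfl
    have a3 : ⟪(0 : ℝ) • Q - γ - g 0, H⟫ = -⟪(0 : ℝ) • Q - γ - g 0, y⟫ := by
      rw [hH, inner_sub_right, inner_smul_right, a2]; ring
    rw [zero_smul, zero_sub, inner_sub_left, inner_neg_left] at a3
    rw [zero_smul, zero_sub] at a1
    rw [h0'] at a3
    linarith
  -- The bounds give `⟪H, H⟫ ≤ m ^ 2 / β`, the reverse of Cauchy–Schwarz against `g 0`, so `H` is a
  -- multiple of `g 0`.
  have hHg : H = (-m) • g 0 := by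
    have a1 : ‖H - (-m) • g 0‖ ^ 2 ≤ 0 := by
      rw [norm_sub_sq_real, norm_smul, inner_smul_right, real_inner_comm (g 0) H, h0', mul_pow,
        ← real_inner_self_eq_norm_sq (g 0), h0, Real.norm_eq_abs, sq_abs,
        ← real_inner_self_eq_norm_sq]
      have a2 : R * ⟪H, H⟫ ≤ R * (m * (1 / β * m)) := by
        have a3 := mul_le_mul_of_nonneg_left hγH (sub_pos.2 hl).le
        calc R * ⟪H, H⟫ = (l₂ - l₁) * ⟪γ, H⟫ := by linarith
          _ ≤ (l₂ - l₁) * (1 / β * m) := a3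
          _ = R * (m * (1 / β * m)) := by rw [← mul_assoc R m]; congr 1; linarith
      have a4 := le_of_mul_le_mul_left a2 hR0
      linarith
    exact sub_eq_zero.1 (norm_eq_zero.1 (pow_eq_zero_iff two_ne_zero |>.1
      (le_antisymm a1 (sq_nonneg _))))
  have hy : y = d • e + m • g 0 := by
    rw [show y = d • e - H by rw [hH]; abel, hHg]; module
  have hg : g l₁ = (p₁ + q₁ * d) • e + (q₁ * m) • g 0 := by
    rw [hg₁, hy]; module
  rw [h.rescaled_eq_zero he hl₁ (mul_pos hq₁ hm0) hg hl0.le hll, ← h1,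
    h.rescaled_eq_zero he hl₁ (mul_pos hq₁ hm0) hg hl₁.le le_rfl]

end Hilbert

/-! ### The projections as vectors of `L²` -/

section Vectors

open RealInnerProductSpace

theorem inner_toLp {f g : ℝ → ℝ} (hf : MemLp f 2 unif) (hg : MemLp g 2 unif) :
    ⟪hf.toLp f, hg.toLp g⟫ = ∫ u, f u * g u ∂unif := by
  rw [L2.inner_def]
  refine integral_congr_ae ?_
  filter_upwards [hf.coeFn_toLp, hg.coeFn_toLp] with u h1 h2
  rw [h1, h2]
  simp [mul_comm]

/-- The constant function `1`. -/
noncomputable def oneVec : Lp ℝ 2 unif := (memLp_const (1 : ℝ)).toLp (fun _ : ℝ => (1 : ℝ))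

theorem inner_oneVec {f : ℝ → ℝ} (hf : MemLp f 2 unif) :
    ⟪oneVec, hf.toLp f⟫ = ∫ u, f u ∂unif := by
  rw [oneVec, inner_toLp]
  simp

theorem norm_oneVec : ‖oneVec‖ = 1 := by
  have h : ‖oneVec‖ ^ 2 = 1 := by
    rw [← real_inner_self_eq_norm_sq]
    nth_rw 2 [oneVec]
    rw [inner_oneVec]
    simp
  exact (pow_eq_one_iff_of_nonneg (norm_nonneg _) two_ne_zero).1 h

theorem toLp_sub_smul_oneVec {f g : ℝ → ℝ} (hf : MemLp f 2 unif) (hg : MemLp g 2 unif) {c : ℝ}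
    (h : ∀ u, f u - c = g u) : hf.toLp f - c • oneVec = hg.toLp g := by
  have e : hf.toLp f - c • oneVec =
    (hf.sub ((memLp_const (1 : ℝ)).const_smul c)).toLp (f - c • fun _ => (1 : ℝ)) := rfl
  rw [e, MemLp.toLp_eq_toLp_iff]
  refine Eventually.of_forall fun u => ?_
  simp [← h u]

theorem centered_toLp {f : ℝ → ℝ} (hf : MemLp f 2 unif) :
    centered oneVec (hf.toLp f) =
      (hf.sub (memLp_const (∫ v, f v ∂unif))).toLp (fun u => f u - ∫ v, f v ∂unif) := by
  rw [centered, inner_oneVec]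
  exact toLp_sub_smul_oneVec _ _ fun u => rfl

theorem norm_centered_toLp {f : ℝ → ℝ} (hf : MemLp f 2 unif) :
    ‖centered oneVec (hf.toLp f)‖ = std f := by
  rw [std, variance_eq_sub hf, ← Real.sqrt_sq (norm_nonneg (centered oneVec _)),
    norm_centered_sq norm_oneVec, inner_oneVec, inner_toLp]
  simp [sq]

theorem std_neg (f : ℝ → ℝ) : std (fun u => -f u) = std f := by
  rw [std, std, variance_fun_neg]

variable {F : Measure ℝ} {α β lam μ σ : ℝ}

/-- The vector of the opposite of the antitonic projection of `γ - lam F⁻¹`. -/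
noncomputable def projVec (F : Measure ℝ) (α β lam : ℝ) : Lp ℝ 2 unif :=
  open Classical in
  if h : MemLp (fun u => -kDown F α β lam u) 2 unif then h.toLp (fun u => -kDown F α β lam u) else 0

theorem projVec_eq (h : MemLp (kDown F α β lam) 2 unif) :
    projVec F α β lam = h.neg.toLp (fun u => -kDown F α β lam u) := by
  have h' : MemLp (fun u => -kDown F α β lam u) 2 unif := h.neg
  rw [projVec, dif_pos h']

theorem exists_blockBounds (hF : MemLp (quantile F) 2 unif) (hα : 0 < α) (hαβ : α < β)
    (hβ : β ≤ 1) (hl : 0 < lam) : ∃ z₀ z₁ c, BlockBounds F α β lam z₀ z₁ c := by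
  obtain ⟨z₀, z₁, c, h⟩ := exists_isBlock (hF.integrable one_le_two) hα hαβ hβ hl
  exact ⟨z₀, z₁, c, h.bounds hα hαβ hβ hl.le⟩

/-- Without tilt, `γ` is averaged over all of `(0, β]`, which gives the level `1 / β`. -/
theorem blockBounds_zero (hα : 0 < α) (hαβ : α < β) (hβ : β ≤ 1) :
    BlockBounds F α β 0 0 β (-1 / β) := by
  have h0 : 0 < β := hα.trans hαβ
  have h1 : 1 / β ≤ 1 / (β - α) := one_div_le_one_div_of_le (by linarith) (by linarith)
  have h2 : 0 < 1 / β := by positivity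
  refine (isBlock_full hα hαβ hβ le_rfl (fun u _ => ?_) (fun u _ _ => ?_) (by simp)).bounds
    hα hαβ hβ le_rfl
  · rw [neg_div]; linarith
  · rw [neg_div]; linarith

theorem isVariational_kDown (hF : MemLp (quantile F) 2 unif) (hα : 0 < α) (hαβ : α < β)
    (hβ : β ≤ 1) (hl : 0 ≤ lam) : IsVariational (tilted F α β lam) (kDown F α β lam) := by
  rcases hl.eq_or_lt with rfl | hl'
  · exact (blockBounds_zero hα hαβ hβ).isVariational_kDown hF hα hαβ hβ hl
  · obtain ⟨z₀, z₁, c, h⟩ := exists_blockBounds hF hα hαβ hβ hl'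
    exact h.isVariational_kDown hF hα hαβ hβ hl

theorem kDown_zero (hF : MemLp (quantile F) 2 unif) (hα : 0 < α) (hαβ : α < β) (hβ : β ≤ 1)
    {u : ℝ} (hu : u ∈ Ioo (0 : ℝ) 1) : kDown F α β 0 u = if u ≤ β then 1 / β else 0 := by
  rw [(blockBounds_zero hα hαβ hβ).kDown_eq hF hα hαβ hβ le_rfl u hu, blockForm,
    if_neg (not_le.2 hu.1)]
  split_ifs <;> simp [neg_div]

theorem const_mem_antitoneCone (c : ℝ) : (fun _ => c) ∈ antitoneCone :=
  ⟨antitoneOn_const, fun _ _ => continuousWithinAt_const, memLp_const c⟩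

theorem neg_quantile_mem_antitoneCone {G : Measure ℝ} (hG : MemLp (quantile G) 2 unif) :
    (fun u => -quantile G u) ∈ antitoneCone :=
  ⟨(monotoneOn_quantile G).neg, fun _ hu => (continuousWithinAt_quantile G hu).neg, hG.neg⟩

theorem inner_residual (hF : MemLp (quantile F) 2 unif) (hk : MemLp (kDown F α β lam) 2 unif)
    {f : ℝ → ℝ} (hf : MemLp f 2 unif) :
    ⟪lam • hF.toLp (quantile F) - memLp_rvarWeight.toLp (rvarWeight α β) - projVec F α β lam,
      hf.toLp f⟫ = ∫ u, (tilted F α β lam u - kDown F α β lam u) * -f u ∂unif := by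
  have e : lam • hF.toLp (quantile F) - memLp_rvarWeight.toLp (rvarWeight α β) -
      projVec F α β lam = (((hF.const_smul lam).sub memLp_rvarWeight).sub hk.neg).toLp
        (lam • quantile F - rvarWeight α β - fun u => -kDown F α β lam u) := by
    rw [projVec_eq hk]
    rfl
  rw [e, inner_toLp]
  refine integral_congr_ae (Eventually.of_forall fun u => ?_)
  simp only [Pi.sub_apply, Pi.smul_apply, smul_eq_mul, tilted]
  ring

theorem inner_residual_le (hF : MemLp (quantile F) 2 unif) (hα : 0 < α) (hαβ : α < β)
    (hβ : β ≤ 1) (hl : 0 ≤ lam) {f : ℝ → ℝ} (hf : MemLp f 2 unif)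
    (hf' : (fun u => -f u) ∈ antitoneCone) :
    ⟪lam • hF.toLp (quantile F) - memLp_rvarWeight.toLp (rvarWeight α β) - projVec F α β lam,
      hf.toLp f⟫ ≤ 0 := by
  have hv := isVariational_kDown hF hα hαβ hβ hl
  rw [inner_residual hF hv.mem.2.2 hf]
  exact hv.le _ hf'

theorem inner_residual_oneVec (hF : MemLp (quantile F) 2 unif) (hα : 0 < α) (hαβ : α < β)
    (hβ : β ≤ 1) (hl : 0 ≤ lam) :
    ⟪lam • hF.toLp (quantile F) - memLp_rvarWeight.toLp (rvarWeight α β) - projVec F α β lam,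
      oneVec⟫ = 0 := by
  have h1 := inner_residual_le hF hα hαβ hβ hl (memLp_const (1 : ℝ))
    (const_mem_antitoneCone (-1))
  have h2 := inner_residual_le hF hα hαβ hβ hl (f := fun _ => -1) (memLp_const (-1 : ℝ))
    (const_mem_antitoneCone (- -1))
  have e : (memLp_const (-1 : ℝ)).toLp (fun _ : ℝ => (-1 : ℝ)) = -oneVec := rfl
  rw [e, inner_neg_right] at h2
  exact le_antisymm h1 (by linarith)

theorem isProjectionFamily_projVec (hF : MemLp (quantile F) 2 unif) (hα : 0 < α) (hαβ : α < β)
    (hβ : β ≤ 1)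
    (hne : ∀ l, 0 < l → ¬ ∃ C : ℝ, ∀ u ∈ Ioo (0 : ℝ) 1, kDown F α β l u = C) :
    IsProjectionFamily oneVec (hF.toLp (quantile F)) (memLp_rvarWeight.toLp (rvarWeight α β))
      (projVec F α β) := by
  have hv := fun l (hl : 0 ≤ l) => isVariational_kDown (lam := l) hF hα hαβ hβ hl
  refine ⟨fun l hl l' hl' => ?_, fun l hl => ?_, fun l hl => ?_,
    fun l hl => inner_residual_oneVec hF hα hαβ hβ hl, fun l hl h0 => hne l hl ?_⟩
  · rw [projVec_eq (hv l' hl').mem.2.2]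
    refine inner_residual_le hF hα hαβ hβ hl _ ?_
    simpa only [neg_neg] using (hv l' hl').mem
  · nth_rw 2 [projVec_eq (hv l hl).mem.2.2]
    rw [inner_residual hF (hv l hl).mem.2.2]
    simpa only [neg_neg] using (hv l hl).eq
  · exact inner_residual_le hF hα hαβ hβ hl hF (neg_quantile_mem_antitoneCone hF)
  -- A vanishing centred part makes the projection constant almost everywhere, hence everywhere by
  -- left-continuity.
  · have hm := (hv l hl.le).mem
    refine ⟨-∫ v, -kDown F α β l v ∂unif, eqOn_of_ae_eq hm.2.1
      (fun _ _ => continuousWithinAt_const) ?_⟩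
    rw [projVec_eq hm.2.2, centered_toLp, Lp.eq_zero_iff_ae_eq_zero] at h0
    filter_upwards [(MemLp.coeFn_toLp _).symm.trans h0] with u hu
    simp only [Pi.zero_apply] at hu
    linarith

/-! ### The functions `hDown` -/

theorem memLp_hDown (hk : MemLp (kDown F α β lam) 2 unif) :
    MemLp (hDown F μ σ α β lam) 2 unif := by
  have h : MemLp (fun u => μ + (σ / std (kDown F α β lam)) *
      ((∫ v, kDown F α β lam v ∂unif) - kDown F α β lam u)) 2 unif :=
    (memLp_const μ).add (((memLp_const _).sub hk).const_mul _)
  refine h.ae_eq (Eventually.of_forall fun u => ?_)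
  simp only [hDown]
  ring

theorem rescaled_projVec (hk : MemLp (kDown F α β lam) 2 unif) :
    rescaled oneVec μ σ (projVec F α β lam) =
      (memLp_hDown hk).toLp (hDown F μ σ α β lam) := by
  have hk' : MemLp (fun u => -kDown F α β lam u) 2 unif := hk.neg
  have e1 : projVec F α β lam = hk'.toLp (fun u => -kDown F α β lam u) := projVec_eq hk
  rw [e1, rescaled, norm_centered_toLp, std_neg, centered_toLp]
  have e2 : μ • oneVec + (σ / std (kDown F α β lam)) •
      (hk'.sub (memLp_const (∫ v, -kDown F α β lam v ∂unif))).toLp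
        (fun u => -kDown F α β lam u - ∫ v, -kDown F α β lam v ∂unif) =
      (((memLp_const (1 : ℝ)).const_smul μ).add ((hk'.sub (memLp_const
        (∫ v, -kDown F α β lam v ∂unif))).const_smul (σ / std (kDown F α β lam)))).toLp
        ((μ • fun _ => (1 : ℝ)) + (σ / std (kDown F α β lam)) •
          fun u => -kDown F α β lam u - ∫ v, -kDown F α β lam v ∂unif) := rfl
  rw [e2, MemLp.toLp_eq_toLp_iff]
  refine Eventually.of_forall fun u => ?_
  simp only [Pi.add_apply, Pi.smul_apply, smul_eq_mul, hDown, integral_neg]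
  ring

theorem monotoneOn_hDown (hσ : 0 < σ) (hk : kDown F α β lam ∈ antitoneCone) :
    MonotoneOn (hDown F μ σ α β lam) (Ioo 0 1) := by
  intro u hu v hv huv
  have h1 := hk.1 hu hv huv
  have h2 : 0 ≤ std (kDown F α β lam) := Real.sqrt_nonneg _
  unfold hDown
  gcongr

theorem continuousWithinAt_hDown (hk : kDown F α β lam ∈ antitoneCone) (u : ℝ)
    (hu : u ∈ Ioo (0 : ℝ) 1) : ContinuousWithinAt (hDown F μ σ α β lam) (Iic u) u :=
  continuousWithinAt_const.add
    ((continuousWithinAt_const.mul (continuousWithinAt_const.sub (hk.2.1 u hu))).div_const _)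

/-- With the moments fixed, only the correlation varies with `lam`; this is how `c₀` enters. -/
theorem inner_rescaled_eq_corr (hF : MemLp (quantile F) 2 unif)
    (hk : MemLp (kDown F α β lam) 2 unif) (hQ : std (quantile F) ≠ 0) :
    ⟪hF.toLp (quantile F), rescaled oneVec μ σ (projVec F α β lam)⟫ =
      μ * (∫ u, quantile F u ∂unif) +
        σ * std (quantile F) * corr (quantile F) (fun u => -kDown F α β lam u) := by
  have hk' : MemLp (fun u => -kDown F α β lam u) 2 unif := hk.neg
  have e1 : projVec F α β lam = hk'.toLp (fun u => -kDown F α β lam u) := projVec_eq hk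
  rw [rescaled, inner_add_right, inner_smul_right, inner_smul_right, real_inner_comm, inner_oneVec,
    inner_centered, e1, inner_toLp, inner_oneVec, inner_oneVec, norm_centered_toLp, corr,
    covariance_eq_sub hF hk']
  simp only [Pi.mul_apply]
  field_simp

/-! ### Wasserstein balls in terms of inner products -/

theorem integral_sub_sq {f g : ℝ → ℝ} (hf : MemLp f 2 unif) (hg : MemLp g 2 unif) :
    ∫ u, (f u - g u) ^ 2 ∂unif =
      ⟪hf.toLp f, hf.toLp f⟫ + ⟪hg.toLp g, hg.toLp g⟫ - 2 * ⟪hf.toLp f, hg.toLp g⟫ := by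
  rw [inner_toLp, inner_toLp, inner_toLp, ← integral_const_mul]
  have i1 : Integrable (fun u => f u * f u) unif := hf.integrable_mul hf
  have i2 : Integrable (fun u => g u * g u) unif := hg.integrable_mul hg
  have i3 : Integrable (fun u => f u * g u) unif := hf.integrable_mul hg
  have i12 : Integrable (fun u => f u * f u + g u * g u) unif := i1.add i2
  rw [← integral_add i1 i2, ← integral_sub i12 (i3.const_mul 2)]
  refine integral_congr_ae (Eventually.of_forall fun u => ?_)
  simp only
  ring

theorem W2_eq_inner [IsProbabilityMeasure F] {G : Measure ℝ} [IsProbabilityMeasure G]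
    (hF : MemLp (quantile F) 2 unif) {h : ℝ → ℝ} (hh : MemLp h 2 unif)
    (he : ∀ u ∈ Ioo (0 : ℝ) 1, quantile G u = h u) :
    W2 F G = ENNReal.ofReal (√(⟪hF.toLp (quantile F), hF.toLp (quantile F)⟫ +
      ⟪hh.toLp h, hh.toLp h⟫ - 2 * ⟪hF.toLp (quantile F), hh.toLp h⟫)) := by
  have he' : quantile G =ᵐ[unif] h := ae_unif he
  have hG : MemLp (quantile G) 2 unif := hh.ae_eq he'.symm
  rw [W2_eq_ofReal F G hF hG, ← integral_sub_sq hF hh]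
  congr 2
  refine integral_congr_ae ?_
  filter_upwards [he'] with u hu
  rw [hu]

theorem ofReal_sqrt_le_iff {a b : ℝ} (hb : 0 ≤ b) :
    ENNReal.ofReal (√a) ≤ ENNReal.ofReal (√b) ↔ a ≤ b := by
  rw [ENNReal.ofReal_le_ofReal_iff (Real.sqrt_nonneg _), Real.sqrt_le_sqrt_iff hb]

theorem ofReal_sqrt_eq_iff {a b : ℝ} (ha : 0 ≤ a) (hb : 0 ≤ b) :
    ENNReal.ofReal (√a) = ENNReal.ofReal (√b) ↔ a = b := by
  rw [ENNReal.ofReal_eq_ofReal_iff (Real.sqrt_nonneg _) (Real.sqrt_nonneg _),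
    Real.sqrt_inj ha hb]

end Vectors

/-! ### Nonconstancy of the projections and uniqueness of the multiplier -/

section Uniqueness

open RealInnerProductSpace

variable {F : Measure ℝ} {α β lam μ σ : ℝ}

theorem integral_unif (f : ℝ → ℝ) : ∫ u, f u ∂unif = ∫ u in (0 : ℝ)..1, f u := by
  rw [unif, restrict_Ioo_eq_restrict_Ioc, intervalIntegral.integral_of_le zero_le_one]

theorem integral_rvarWeight_unif (hα : 0 < α) (hαβ : α < β) (hβ : β ≤ 1) :
    ∫ u, rvarWeight α β u ∂unif = 1 := by
  have h : ∫ u, rvarWeight α β u ∂unif = ∫ u in α..β, (fun _ => 1 / (β - α)) u :=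
    integral_unif_indicator hα.le hαβ.le hβ
  have h' : β - α ≠ 0 := (sub_pos.2 hαβ).ne'
  rw [h, intervalIntegral.integral_const, smul_eq_mul]
  field_simp

theorem inner_rvarWeight_oneVec (hα : 0 < α) (hαβ : α < β) (hβ : β ≤ 1) :
    ⟪memLp_rvarWeight.toLp (rvarWeight α β), oneVec⟫ = 1 := by
  rw [real_inner_comm, inner_oneVec, integral_rvarWeight_unif hα hαβ hβ]

theorem inner_oneVec_projVec (hF : MemLp (quantile F) 2 unif) (hα : 0 < α) (hαβ : α < β)
    (hβ : β ≤ 1) (hl : 0 ≤ lam) :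
    ⟪oneVec, projVec F α β lam⟫ = lam * (∫ u, quantile F u ∂unif) - 1 := by
  have h := inner_residual_oneVec hF hα hαβ hβ hl
  rw [inner_sub_left, inner_sub_left, inner_smul_left, inner_rvarWeight_oneVec hα hαβ hβ,
    real_inner_comm oneVec (hF.toLp _), inner_oneVec, real_inner_comm oneVec] at h
  simp only [RCLike.conj_to_real] at h
  linarith

theorem kDown_of_gt (hF : MemLp (quantile F) 2 unif) (hα : 0 < α) (hαβ : α < β)
    (hβ : β ≤ 1) (hl : 0 < lam) {u : ℝ} (hu : u ∈ Ioo (0 : ℝ) 1) (huβ : β < u) :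
    kDown F α β lam u = -lam * quantile F u := by
  obtain ⟨z₀, z₁, c, h⟩ := exists_blockBounds hF hα hαβ hβ hl
  have := h.le_alpha
  have := h.le_beta
  rw [h.kDown_eq hF hα hαβ hβ hl.le u hu, blockForm, if_neg (by linarith), if_neg (by linarith),
    if_neg (by linarith)]

/-- A block starting at `0` would make `c / lam` a lower bound of the quantile function. -/
theorem kDown_near_zero (hF : MemLp (quantile F) 2 unif) (hα : 0 < α) (hαβ : α < β)
    (hβ : β ≤ 1) (hl : 0 < lam) (hunb : ∀ M, ∃ u ∈ Ioo (0 : ℝ) 1, quantile F u < M) :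
    ∃ δ ∈ Ioo (0 : ℝ) 1, ∀ u ∈ Ioo (0 : ℝ) 1, u ≤ δ →
      kDown F α β lam u = -lam * quantile F u := by
  obtain ⟨z₀, z₁, c, h⟩ := exists_blockBounds hF hα hαβ hβ hl
  have hz : 0 < z₀ := h.zero_le.lt_of_ne fun h0 => by
    obtain ⟨u, hu, hlt⟩ := hunb (c / lam)
    exact absurd (h.left_ge u hu (h0 ▸ hu.1)) (not_le.2 ((lt_div_iff₀' hl).1 hlt))
  refine ⟨z₀, ⟨hz, by linarith [h.le_alpha]⟩, fun u hu huz => ?_⟩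
  rw [h.kDown_eq hF hα hαβ hβ hl.le u hu, blockForm, if_pos huz]

theorem kDown_near_one (hF : MemLp (quantile F) 2 unif) (hα : 0 < α) (hα1 : α < 1)
    (hl : 0 < lam) (hunb : ∀ M, ∃ u ∈ Ioo (0 : ℝ) 1, M < quantile F u) :
    ∃ δ ∈ Ioo (0 : ℝ) 1, ∀ u ∈ Ioo (0 : ℝ) 1, δ < u →
      kDown F α 1 lam u = -lam * quantile F u + 1 / (1 - α) := by
  obtain ⟨z₀, z₁, c, h⟩ := exists_blockBounds hF hα hα1 le_rfl hl
  have hz : z₁ < 1 := h.le_beta.lt_of_ne fun h0 => by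
    obtain ⟨u, hu, hlt⟩ := hunb ((c + 1 / (1 - α)) / lam)
    exact absurd (h.right_le u hu (h0 ▸ hu.2.le)) (not_le.2 ((div_lt_iff₀' hl).1 hlt))
  have h1 := h.le_alpha
  have h2 := h.alpha_le
  refine ⟨z₁, ⟨by linarith, hz⟩, fun u hu huz => ?_⟩
  rw [h.kDown_eq hF hα hα1 le_rfl hl.le u hu, blockForm, if_neg (by linarith),
    if_neg (by linarith), if_pos hu.2.le]

theorem not_const_near_zero (hunb : ∀ M, ∃ u ∈ Ioo (0 : ℝ) 1, quantile F u < M) {δ : ℝ}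
    (hδ : δ ∈ Ioo (0 : ℝ) 1) (C : ℝ) : ¬ ∀ u ∈ Ioo (0 : ℝ) 1, u ≤ δ → quantile F u = C := by
  intro h
  obtain ⟨u, hu, hlt⟩ := hunb C
  rcases le_total u δ with hu' | hu'
  · exact hlt.ne (h u hu hu')
  · exact absurd (monotoneOn_quantile F hδ hu hu') (by rw [h δ hδ le_rfl]; exact not_le.2 hlt)

theorem not_const_near_one (hunb : ∀ M, ∃ u ∈ Ioo (0 : ℝ) 1, M < quantile F u) {δ : ℝ}
    (hδ : δ ∈ Ioo (0 : ℝ) 1) (C : ℝ) : ¬ ∀ u ∈ Ioo (0 : ℝ) 1, δ < u → quantile F u = C := by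
  intro h
  obtain ⟨u, hu, hlt⟩ := hunb C
  rcases le_or_gt u δ with hu' | hu'
  · have hv : (δ + 1) / 2 ∈ Ioo (0 : ℝ) 1 := ⟨by linarith [hδ.1], by linarith [hδ.2]⟩
    have hδv : δ < (δ + 1) / 2 := by linarith [hδ.2]
    exact absurd (monotoneOn_quantile F hu hv (hu'.trans hδv.le))
      (by rw [h _ hv hδv]; exact not_le.2 hlt)
  · exact hlt.ne' (h u hu hu')

/-- For `β = 1`, the projections can only be non-constant for arbitrarily small parameters if the
quantile function is unbounded. -/
theorem unbounded_of_lambdaDown (hF : MemLp (quantile F) 2 unif) (hα : 0 < α) (hα1 : α < 1)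
    (hlam : lambdaDown F α 1 = 0) :
    (∀ M, ∃ u ∈ Ioo (0 : ℝ) 1, quantile F u < M) ∨
      ∀ M, ∃ u ∈ Ioo (0 : ℝ) 1, M < quantile F u := by
  by_contra hcon
  push Not at hcon
  obtain ⟨⟨m, hm⟩, M, hM⟩ := hcon
  have hFi := hF.integrable one_le_two
  set I := ∫ u in (0 : ℝ)..1, quantile F u with hI
  have hmI : m ≤ I := by
    have := integral_mono_ae (integrable_const m) hFi (ae_unif hm)
    rwa [integral_unif (quantile F), integral_const, probReal_univ, one_smul] at this
  have hIM : I ≤ M := by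
    have := integral_mono_ae hFi (integrable_const M) (ae_unif hM)
    rwa [integral_unif (quantile F), integral_const, probReal_univ, one_smul] at this
  set r := 1 / (1 - α) - 1 with hr
  have hr0 : 0 < r := by
    have : 1 < 1 / (1 - α) := (one_lt_div (by linarith)).2 (by linarith)
    linarith
  -- For `l ≤ b` the oscillation of `l F⁻¹` is at most `1` and at most `r`, as the left and right
  -- conditions for the single block `(0, 1]` require. The added `1` keeps the denominator positive
  -- if `M = m`.
  set b := min 1 r / (M - m + 1) with hb
  have hK : 0 < M - m + 1 := by linarith
  have hb0 : 0 < b := div_pos (lt_min one_pos hr0) hK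
  have hconst : ∀ l, 0 ≤ l → l ≤ b → ∀ u ∈ Ioo (0 : ℝ) 1, kDown F α 1 l u = 1 - l * I := by
    intro l hl hlb u hu
    have h1 : l * (M - m) ≤ min 1 r := by
      calc l * (M - m) ≤ b * (M - m + 1) :=
            mul_le_mul hlb (by linarith) (by linarith) hb0.le
        _ = min 1 r := by rw [hb]; field_simp
    have hblock : IsBlock F α 1 l 0 1 (-1 + l * I) := by
      refine isBlock_full hα hα1 le_rfl hl (fun v hv => ?_) (fun v hv _ => ?_) (by simp [hI])
      · have := mul_le_mul_of_nonneg_left (show I - quantile F v ≤ M - m by linarith [hm v hv]) hl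
        have := h1.trans (min_le_left _ _)
        linarith
      · have := mul_le_mul_of_nonneg_left (show quantile F v - I ≤ M - m by linarith [hM v hv]) hl
        have := h1.trans (min_le_right _ _)
        linarith
    rw [(hblock.bounds hα hα1 le_rfl hl).kDown_eq hF hα hα1 le_rfl hl u hu, blockForm,
      if_neg (not_le.2 hu.1), if_pos hu.2.le]
    ring
  have hle : ((b : ℝ) : EReal) ≤ lambdaDown F α 1 := by
    refine le_sInf ?_
    rintro x ⟨l, hl, hne, rfl⟩
    rw [EReal.coe_le_coe_iff]
    by_contra hlt
    exact hne ⟨_, hconst l hl (not_le.1 hlt).le⟩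
  rw [hlam, ← EReal.coe_zero, EReal.coe_le_coe_iff] at hle
  linarith

theorem kDown_not_const (hF : MemLp (quantile F) 2 unif) (hα : 0 < α) (hαβ : α < β)
    (hβ : β ≤ 1) (hlam : lambdaDown F α β = 0) (hl : 0 < lam) :
    ¬ ∃ C : ℝ, ∀ u ∈ Ioo (0 : ℝ) 1, kDown F α β lam u = C := by
  rintro ⟨C, hC⟩
  rcases hβ.lt_or_eq with hβ1 | rfl
  · have hk := (isVariational_kDown hF hα hαβ hβ hl.le).mem.2.2
    have hk' : MemLp (fun u => -kDown F α β lam u) 2 unif := hk.neg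
    have h1 := inner_oneVec_projVec hF hα hαβ hβ hl.le
    have h2 : ⟪oneVec, projVec F α β lam⟫ = ∫ u, -kDown F α β lam u ∂unif := by
      rw [projVec_eq hk]; exact inner_oneVec hk'
    have h3 : ∫ u, -kDown F α β lam u ∂unif = -C := by
      rw [integral_congr_ae (ae_unif (p := fun u => -kDown F α β lam u = -C) fun u hu => by
        rw [hC u hu]), integral_const, probReal_univ, one_smul]
    have hv : (β + 1) / 2 ∈ Ioo (0 : ℝ) 1 := ⟨by linarith, by linarith⟩
    have hvβ : β < (β + 1) / 2 := by linarith
    have h4 : ∀ u ∈ Ioo (0 : ℝ) 1, β < u → lam * quantile F u = -C := fun u hu huβ => by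
      rw [← hC u hu, kDown_of_gt hF hα hαβ hβ hl hu huβ]; ring
    -- The value on `(β, 1)` bounds the quantile function, so the mean of `lam F⁻¹` is at most `-C`;
    -- but the projection preserves means and `γ` has mean `1`, so that mean is `1 - C`.
    have h5 : ∀ u ∈ Ioo (0 : ℝ) 1, lam * quantile F u ≤ -C := fun u hu => by
      rcases le_or_gt u ((β + 1) / 2) with h | h
      · rw [← h4 _ hv hvβ]
        exact mul_le_mul_of_nonneg_left (monotoneOn_quantile F hu hv h) hl.le
      · exact (h4 u hu (hvβ.trans h)).le
    have h6 := integral_mono_ae ((hF.integrable one_le_two).const_mul lam)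
      (integrable_const (-C)) (ae_unif h5)
    rw [integral_const_mul, integral_const, probReal_univ, one_smul] at h6
    linarith
  · rcases unbounded_of_lambdaDown hF hα hαβ hlam with hunb | hunb
    · obtain ⟨δ, hδ, h⟩ := kDown_near_zero hF hα hαβ le_rfl hl hunb
      refine not_const_near_zero hunb hδ (-C / lam) fun u hu huδ => ?_
      rw [eq_div_iff hl.ne', ← hC u hu, h u hu huδ]
      ring
    · obtain ⟨δ, hδ, h⟩ := kDown_near_one hF hα hαβ hl hunb
      refine not_const_near_one hunb hδ ((1 / (1 - α) - C) / lam) fun u hu huδ => ?_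
      rw [eq_div_iff hl.ne', ← hC u hu, h u hu huδ]
      ring

theorem ae_eq_of_toLp_eq_affine {f h : ℝ → ℝ} (hf : MemLp f 2 unif) (hh : MemLp h 2 unif)
    {p q : ℝ} (he : hf.toLp f = p • oneVec + q • hh.toLp h) :
    f =ᵐ[unif] fun u => p + q * h u := by
  have e : p • oneVec + q • hh.toLp h = (((memLp_const (1 : ℝ)).const_smul p).add
      (hh.const_smul q)).toLp ((p • fun _ => (1 : ℝ)) + q • h) := rfl
  rw [e, MemLp.toLp_eq_toLp_iff] at he
  filter_upwards [he] with u hu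
  rw [hu]
  simp

/-- If two members of the family of projections have the same rescaling, then the members before
them have this rescaling, too. -/
theorem rescaled_projVec_eq (hF : MemLp (quantile F) 2 unif) (hα : 0 < α) (hαβ : α < β)
    (hβ : β ≤ 1) (hlam : lambdaDown F α β = 0) (hσ : 0 < σ) {l₁ l₂ : ℝ} (hl₁ : 0 < l₁)
    (hl : l₁ < l₂)
    (heq : rescaled oneVec μ σ (projVec F α β l₁) = rescaled oneVec μ σ (projVec F α β l₂))
    (hlam' : 0 < lam) (hle : lam ≤ l₁) :
    rescaled oneVec μ σ (projVec F α β lam) = rescaled oneVec μ σ (projVec F α β l₁) := by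
  have hl₂ := hl₁.trans hl
  have fam := isProjectionFamily_projVec hF hα hαβ hβ
    fun l hl => kDown_not_const hF hα hαβ hβ hlam hl
  have hm : ∀ l, 0 ≤ l → kDown F α β l ∈ antitoneCone := fun l hl =>
    (isVariational_kDown hF hα hαβ hβ hl).mem
  set y := rescaled oneVec μ σ (projVec F α β l₁) with hy
  set h := hDown F μ σ α β l₁ with hh
  have hhm : MemLp h 2 unif := memLp_hDown (hm l₁ hl₁.le).2.2
  have hyh : y = hhm.toLp h := rescaled_projVec (hm l₁ hl₁.le).2.2
  have hc := continuousWithinAt_hDown (μ := μ) (σ := σ) (hm l₁ hl₁.le)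
  have hmono := monotoneOn_hDown (μ := μ) hσ (hm l₁ hl₁.le)
  set q : ℝ → ℝ := fun l => ‖centered oneVec (projVec F α β l)‖ / σ with hq
  set p : ℝ → ℝ := fun l => ⟪oneVec, projVec F α β l⟫ - q l * μ with hp
  have hq0 : ∀ l, 0 < l → 0 < q l := fun l hl => div_pos (norm_pos_iff.2 (fam.ne l hl)) hσ
  have hg₁ : projVec F α β l₁ = p l₁ • oneVec + q l₁ • y := eq_rescaled hσ (fam.ne l₁ hl₁)
  have hg₂ : projVec F α β l₂ = p l₂ • oneVec + q l₂ • y := by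
    rw [heq]; exact eq_rescaled hσ (fam.ne l₂ hl₂)
  have pw : ∀ l, 0 < l → projVec F α β l = p l • oneVec + q l • y →
      ∀ u ∈ Ioo (0 : ℝ) 1, -kDown F α β l u = p l + q l * h u := by
    intro l hl hg
    rw [projVec_eq (hm l hl.le).2.2, hyh] at hg
    exact eqOn_of_ae_eq (fun u hu => ((hm l hl.le).2.1 u hu).neg)
      (fun u hu => continuousWithinAt_const.add (continuousWithinAt_const.mul (hc u hu)))
      (ae_eq_of_toLp_eq_affine _ _ hg)
  set P := l₂ * p l₁ - l₁ * p l₂ with hP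
  set R := l₂ * q l₁ - l₁ * q l₂ with hR
  -- Comparison of means; it excludes `R = 0` in each case below.
  have hPR : P + R * μ = -(l₂ - l₁) := by
    have e1 := inner_oneVec_projVec hF hα hαβ hβ hl₁.le
    have e2 := inner_oneVec_projVec hF hα hαβ hβ hl₂.le
    simp only [hP, hR, hp, e1, e2]
    ring
  have comb : ∀ u ∈ Ioo (0 : ℝ) 1,
      l₂ * -kDown F α β l₁ u - l₁ * -kDown F α β l₂ u = P + R * h u := fun u hu => by
    rw [pw l₁ hl₁ hg₁ u hu, pw l₂ hl₂ hg₂ u hu, hP, hR]; ring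
  rcases hβ.lt_or_eq with hβ1 | rfl
  -- Beyond `β` both projections are `-l F⁻¹`, which the combination cancels. So `h` is constant
  -- there, and `d - h` is nonnegative and supported in `(0, β]`.
  · have hzero : ∀ u ∈ Ioo (0 : ℝ) 1, β < u → P + R * h u = 0 := fun u hu huβ => by
      rw [← comb u hu, kDown_of_gt hF hα hαβ hβ hl₁ hu huβ,
        kDown_of_gt hF hα hαβ hβ hl₂ hu huβ]
      ring
    have hv : (β + 1) / 2 ∈ Ioo (0 : ℝ) 1 := ⟨by linarith, by linarith⟩
    have hvβ : β < (β + 1) / 2 := by linarith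
    have hv0 := hzero _ hv hvβ
    have hR0 : R ≠ 0 := fun h0 => by
      rw [h0] at hv0 hPR
      linarith
    set d := h ((β + 1) / 2) with hd
    have hd' : ∀ u ∈ Ioo (0 : ℝ) 1, β < u → h u = d := fun u hu huβ =>
      mul_left_cancel₀ hR0 (by linarith [hzero u hu huβ])
    have hH : ∀ u ∈ Ioo (0 : ℝ) 1, 0 ≤ d - h u := fun u hu => by
      rcases le_or_gt u ((β + 1) / 2) with h' | h'
      · exact sub_nonneg.2 (hmono hu hv h')
      · rw [hd' u hu (hvβ.trans h'), sub_self]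
    have hHm : MemLp (fun u => d - h u) 2 unif := (memLp_const d).sub hhm
    have hHv : d • oneVec - y = hHm.toLp (fun u => d - h u) := by
      have e : d • oneVec - hhm.toLp h =
        (((memLp_const (1 : ℝ)).const_smul d).sub hhm).toLp ((d • fun _ => (1 : ℝ)) - h) := rfl
      rw [hyh, e, MemLp.toLp_eq_toLp_iff]
      exact Eventually.of_forall fun u => by simp
    have hk0 : MemLp (fun u => -kDown F α β 0 u) 2 unif := (hm 0 le_rfl).2.2.neg
    have hg0 : projVec F α β 0 = hk0.toLp (fun u => -kDown F α β 0 u) :=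
      projVec_eq (hm 0 le_rfl).2.2
    refine fam.rescaled_eq_of_collapse norm_oneVec hσ (inner_rvarWeight_oneVec hα hαβ hβ) hl₁ hl
      rfl (hq0 l₁ hl₁) (hq0 l₂ hl₂) hg₁ hg₂ hv0 (β := β) ?_ ?_ ?_ hlam' hle
    · rw [hHv, inner_oneVec]
      exact integral_nonneg_of_ae (ae_unif hH)
    · have e := inner_oneVec_projVec hF hα hαβ hβ le_rfl
      rw [hg0, inner_oneVec, zero_mul, zero_sub] at e
      rw [hg0, inner_toLp, integral_congr_ae (ae_unif (p := fun u =>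
        -kDown F α β 0 u * -kDown F α β 0 u = -(1 / β) * -kDown F α β 0 u) fun u hu => by
          rw [kDown_zero hF hα hαβ hβ hu]; split_ifs <;> simp), integral_const_mul, e]
      ring
    · rw [hHv, hg0, inner_toLp, inner_oneVec, ← integral_const_mul]
      refine integral_congr_ae (ae_unif fun u hu => ?_)
      beta_reduce
      rw [kDown_zero hF hα hαβ hβ hu]
      split_ifs with h'
      · rfl
      · rw [hd' u hu (not_le.1 h')]; simp
  -- With `β = 1` the combination of the two projections is constant on a tail where the quantile
  -- function is unbounded; `h`, and with it the quantile function, would be constant there.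
  · exfalso
    rcases unbounded_of_lambdaDown hF hα hαβ hlam with hunb | hunb
    · obtain ⟨δ₁, hδ₁, h1⟩ := kDown_near_zero hF hα hαβ le_rfl hl₁ hunb
      obtain ⟨δ₂, hδ₂, h2⟩ := kDown_near_zero hF hα hαβ le_rfl hl₂ hunb
      have hδ : min δ₁ δ₂ ∈ Ioo (0 : ℝ) 1 :=
        ⟨lt_min hδ₁.1 hδ₂.1, (min_le_left _ _).trans_lt hδ₁.2⟩
      have hzero : ∀ u ∈ Ioo (0 : ℝ) 1, u ≤ min δ₁ δ₂ → P + R * h u = 0 := fun u hu hu' => by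
        rw [← comb u hu, h1 u hu (hu'.trans (min_le_left _ _)),
          h2 u hu (hu'.trans (min_le_right _ _))]
        ring
      have hR0 : R ≠ 0 := fun h0 => by
        have := hzero _ hδ le_rfl
        rw [h0] at this hPR
        linarith
      refine not_const_near_zero hunb hδ ((p l₁ + q l₁ * (-P / R)) / l₁) fun u hu hu' => ?_
      have e1 : h u = -P / R := by
        rw [eq_div_iff hR0]; linarith [hzero u hu hu']
      rw [eq_div_iff hl₁.ne', ← e1, ← pw l₁ hl₁ hg₁ u hu, h1 u hu (hu'.trans (min_le_left _ _))]
      ring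
    · obtain ⟨δ₁, hδ₁, h1⟩ := kDown_near_one hF hα hαβ hl₁ hunb
      obtain ⟨δ₂, hδ₂, h2⟩ := kDown_near_one hF hα hαβ hl₂ hunb
      have hδ : max δ₁ δ₂ ∈ Ioo (0 : ℝ) 1 :=
        ⟨hδ₁.1.trans_le (le_max_left _ _), max_lt hδ₁.2 hδ₂.2⟩
      have hzero : ∀ u ∈ Ioo (0 : ℝ) 1, max δ₁ δ₂ < u →
          P + R * h u = -(l₂ - l₁) * (1 / (1 - α)) := fun u hu hu' => by
        rw [← comb u hu, h1 u hu ((le_max_left _ _).trans_lt hu'),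
          h2 u hu ((le_max_right _ _).trans_lt hu')]
        ring
      have hR0 : R ≠ 0 := fun h0 => by
        have h3 := hzero ((max δ₁ δ₂ + 1) / 2) ⟨by linarith [hδ.1], by linarith [hδ.2]⟩
          (by linarith [hδ.2])
        rw [h0] at h3 hPR
        have h4 : 1 < 1 / (1 - α) := (one_lt_div (by linarith)).2 (by linarith)
        nlinarith
      refine not_const_near_one hunb hδ ((p l₁ + q l₁ * ((-(l₂ - l₁) * (1 / (1 - α)) - P) / R) +
        1 / (1 - α)) / l₁) fun u hu hu' => ?_
      have e1 : h u = (-(l₂ - l₁) * (1 / (1 - α)) - P) / R := by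
        rw [eq_div_iff hR0]; linarith [hzero u hu hu']
      rw [eq_div_iff hl₁.ne', ← e1, ← pw l₁ hl₁ hg₁ u hu,
        h1 u hu ((le_max_left _ _).trans_lt hu')]
      ring

end Uniqueness

/-! ### Optimality of the rescaled projection -/

section BestCase

open RealInnerProductSpace

variable {F : Measure ℝ} {α β lam μ σ ε : ℝ}

theorem inner_self_eq_of_std {y : Lp ℝ 2 unif} (h1 : ⟪oneVec, y⟫ = μ)
    (h2 : ‖centered oneVec y‖ = σ) : ⟪y, y⟫ = μ ^ 2 + σ ^ 2 := by
  have := norm_centered_sq norm_oneVec y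
  rw [h1, h2] at this
  linarith

theorem norm_centered_eq_of_inner_self (hσ : 0 < σ) {y : Lp ℝ 2 unif} (h1 : ⟪oneVec, y⟫ = μ)
    (h2 : ⟪y, y⟫ = μ ^ 2 + σ ^ 2) : ‖centered oneVec y‖ = σ := by
  have := norm_centered_sq norm_oneVec y
  rw [h1, h2, add_sub_cancel_left] at this
  exact (pow_left_inj₀ (norm_nonneg _) hσ.le two_ne_zero).1 this

section Moments

variable (G : Measure ℝ) [IsProbabilityMeasure G]

theorem inner_oneVec_quantile (hG : MemLp (quantile G) 2 unif) :
    ⟪oneVec, hG.toLp (quantile G)⟫ = ∫ x, x ∂G := by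
  rw [inner_oneVec]
  exact integral_quantile G measurable_id

theorem inner_quantile_self (hG : MemLp (quantile G) 2 unif) :
    ⟪hG.toLp (quantile G), hG.toLp (quantile G)⟫ = ∫ x, x ^ 2 ∂G := by
  rw [inner_toLp, ← integral_quantile G (by fun_prop : Measurable fun x : ℝ => x ^ 2)]
  simp only [sq]

end Moments

theorem RVaR_eq_inner (G : Measure ℝ) (hG : MemLp (quantile G) 2 unif) :
    RVaR α β G = ⟪memLp_rvarWeight.toLp (rvarWeight α β), hG.toLp (quantile G)⟫ := by
  rw [inner_toLp]
  rfl

/-- The law of `hDown` is the unique best-case distribution if it lies on the sphere of radius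
`√ε` about `F`. -/
theorem bestCase_eq_singleton [IsProbabilityMeasure F] (hF : MemLp (quantile F) 2 unif)
    (hα : 0 < α) (hαβ : α < β) (hβ : β ≤ 1)
    (hne : ∀ l, 0 < l → ¬ ∃ C : ℝ, ∀ u ∈ Ioo (0 : ℝ) 1, kDown F α β l u = C)
    (hσ : 0 < σ) (hε : 0 ≤ ε) (hl : 0 < lam)
    (hW : W2 F (lawOf (hDown F μ σ α β lam)) = ENNReal.ofReal (√ε)) :
    bestCase F μ σ ε α β = {lawOf (hDown F μ σ α β lam)} := by
  have fam := isProjectionFamily_projVec hF hα hαβ hβ hne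
  have hk := (isVariational_kDown hF hα hαβ hβ hl.le).mem
  set h := hDown F μ σ α β lam with hh
  have hhm : MemLp h 2 unif := memLp_hDown hk.2.2
  have hmono : MonotoneOn h (Ioo 0 1) := monotoneOn_hDown hσ hk
  have hprob := isProbabilityMeasure_lawOf hmono
  have hquant : ∀ u ∈ Ioo (0 : ℝ) 1, quantile (lawOf h) u = h u := fun u hu =>
    quantile_lawOf hmono (continuousWithinAt_hDown hk) hu
  set y := rescaled oneVec μ σ (projVec F α β lam) with hy
  have hyh : y = hhm.toLp h := rescaled_projVec hk.2.2
  have hy1 : ⟪oneVec, y⟫ = μ := inner_e_rescaled norm_oneVec _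
  have hy2 : ‖centered oneVec y‖ = σ := norm_centered_rescaled norm_oneVec hσ (fam.ne lam hl)
  have hy3 := inner_self_eq_of_std hy1 hy2
  have hQm : MemLp (quantile (lawOf h)) 2 unif := hhm.ae_eq (ae_unif fun u hu => (hquant u hu).symm)
  have hQy : hQm.toLp (quantile (lawOf h)) = y := by
    rw [hyh, MemLp.toLp_eq_toLp_iff]
    exact ae_unif hquant
  have hW' := hW
  rw [W2_eq_inner hF hhm hquant, ← integral_sub_sq hF hhm,
    ofReal_sqrt_eq_iff (integral_nonneg fun _ => sq_nonneg _) hε, integral_sub_sq hF hhm, ← hyh,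
    hy3] at hW'
  have hmem : lawOf h ∈ uncertaintySet F μ σ ε := by
    refine ⟨⟨hprob, ?_⟩, ?_, ?_, hW.le⟩
    · exact (memLp_map_measure_iff aestronglyMeasurable_id (aemeasurable_of_monotoneOn hmono)).2 hhm
    · rw [← inner_oneVec_quantile _ hQm, hQy, hy1]
    · rw [← inner_quantile_self _ hQm, hQy, hy3]
  have hc : 0 < ‖centered oneVec (projVec F α β lam)‖ / (2 * σ) :=
    div_pos (norm_pos_iff.2 (fam.ne lam hl)) (by positivity)
  have key : ∀ G ∈ uncertaintySet F μ σ ε, ∃ hG : MemLp (quantile G) 2 unif,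
      RVaR α β (lawOf h) + ‖centered oneVec (projVec F α β lam)‖ / (2 * σ) *
        ‖hG.toLp (quantile G) - y‖ ^ 2 ≤ RVaR α β G := by
    rintro G ⟨⟨hG, hG2⟩, hG3, hG4, hG5⟩
    have hGm := memLp_quantile G hG2
    refine ⟨hGm, ?_⟩
    set x := hGm.toLp (quantile G) with hx
    have hx1 : ⟪oneVec, x⟫ = μ := (inner_oneVec_quantile G hGm).trans hG3
    have hx3 : ⟪x, x⟫ = μ ^ 2 + σ ^ 2 := (inner_quantile_self G hGm).trans hG4
    have hx2 := norm_centered_eq_of_inner_self hσ hx1 hx3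
    rw [W2_eq_inner hF hGm (fun _ _ => rfl), ofReal_sqrt_le_iff hε, ← hx, hx3] at hG5
    have h1 := inner_add_le_inner_rescaled norm_oneVec hσ (fam.ne lam hl)
      (inner_residual_le hF hα hαβ hβ hl.le hGm (neg_quantile_mem_antitoneCone hGm))
      (fam.eq_e lam hl.le) (fam.eq lam hl.le) hx1 hx2
    rw [RVaR_eq_inner _ hQm, RVaR_eq_inner _ hGm, hQy]
    simp only [inner_sub_left, inner_smul_left, RCLike.conj_to_real] at h1
    -- With equal second moments, being no farther from `F` than `y` is means having at least its
    -- inner product with `F⁻¹`; the multiplier weighs this inequality.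
    have h2 := mul_le_mul_of_nonneg_left (show ⟪hF.toLp (quantile F), y⟫ ≤
      ⟪hF.toLp (quantile F), x⟫ by linarith) hl.le
    linarith
  refine Set.eq_singleton_iff_unique_mem.2 ⟨⟨hmem, fun G hG => ?_⟩, fun G hG => ?_⟩
  · obtain ⟨hGm, h1⟩ := key G hG
    have : 0 ≤ ‖centered oneVec (projVec F α β lam)‖ / (2 * σ) *
      ‖hGm.toLp (quantile G) - y‖ ^ 2 := by positivity
    linarith
  · obtain ⟨hGm, h1⟩ := key G hG.1
    have h2 := hG.2 _ hmem
    have h3 : ‖hGm.toLp (quantile G) - y‖ ^ 2 = 0 := by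
      refine le_antisymm ?_ (sq_nonneg _)
      by_contra hcon
      have := mul_pos hc (not_le.1 hcon)
      linarith
    have h4 := sub_eq_zero.1 (norm_eq_zero.1 (pow_eq_zero_iff two_ne_zero |>.1 h3))
    rw [hyh, MemLp.toLp_eq_toLp_iff] at h4
    have := hG.1.1.1
    rw [← map_quantile G]
    exact Measure.map_congr h4

end BestCase

end BestCaseRVaR

/-! ### The main theorem -/

open BestCaseRVaR in
theorem mainTheorem6
    (F : Measure ℝ) (hF : F ∈ M2)
    (μF σF : ℝ) (hμF : ∫ x, x ∂F = μF) (hσF_pos : 0 < σF)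
    (hσF : ∫ x, x ^ 2 ∂F = μF ^ 2 + σF ^ 2)
    (μ σ : ℝ) (hσ : 0 < σ)
    (α β : ℝ) (hα : 0 < α) (hαβ : α < β) (hβ : β ≤ 1)
    (hlam : lambdaDown F α β = 0)
    (c₀ : ℝ)
    (hc₀ : Tendsto (fun lam => corr (quantile F) (fun u => -kDown F α β lam u))
      (𝓝[>] 0) (𝓝 c₀))
    (ε : ℝ) (hε_low : (μF - μ) ^ 2 + (σF - σ) ^ 2 < ε)
    (hε_up : ε < (μF - μ) ^ 2 + (σF - σ) ^ 2 + 2 * σ * σF * (1 - c₀)) :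
    ∃ lam : ℝ,
      (0 < lam ∧ W2 F (lawOf (hDown F μ σ α β lam)) = ENNReal.ofReal (√ε) ∧
        ∀ lam' : ℝ, 0 < lam' →
          W2 F (lawOf (hDown F μ σ α β lam')) = ENNReal.ofReal (√ε) → lam' = lam) ∧
      (∃ G : Measure ℝ, bestCase F μ σ ε α β = {G} ∧
        ∀ u ∈ Ioo (0 : ℝ) 1, quantile G u = hDown F μ σ α β lam u) ∧
      IsAntitonicProjection (tilted F α β lam) (kDown F α β lam) ∧
      (∃ z₀ z₁ c : ℝ, IsBlock F α β lam z₀ z₁ c) ∧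
      (∀ z₀ z₁ c : ℝ, IsBlock F α β lam z₀ z₁ c →
        (∀ u ∈ Ioo (0 : ℝ) 1, kDown F α β lam u = blockForm F α β lam z₀ z₁ c u) ∧
        (ContinuousOn (quantile F) (Ioo 0 1) → BlockEquations F α β lam z₀ z₁ c)) := by
  have := hF.1
  have hQ := memLp_quantile F hF.2
  have hne := fun l (hl : 0 < l) => kDown_not_const (lam := l) hQ hα hαβ hβ hlam hl
  have fam := isProjectionFamily_projVec hQ hα hαβ hβ hne
  have hε : 0 ≤ ε := by nlinarith [sq_nonneg (μF - μ), sq_nonneg (σF - σ)]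
  set q := hQ.toLp (quantile F) with hq
  have hq1 : inner ℝ oneVec q = μF := (inner_oneVec_quantile F hQ).trans hμF
  have hq2 : inner ℝ q q = μF ^ 2 + σF ^ 2 := (inner_quantile_self F hQ).trans hσF
  have hq3 := norm_centered_eq_of_inner_self hσF_pos hq1 hq2
  have hstd : std (quantile F) = σF := (norm_centered_toLp hQ).symm.trans hq3
  have hqc : centered oneVec q ≠ 0 := norm_pos_iff.1 (hq3 ▸ hσF_pos)
  set T : ℝ → ℝ := fun l => inner ℝ q (rescaled oneVec μ σ (projVec F α β l)) with hT
  -- The inner product with `F⁻¹` at which the squared distance equals `ε`, given the moments.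
  set t := (μF ^ 2 + σF ^ 2 + (μ ^ 2 + σ ^ 2) - ε) / 2 with ht
  have hk := fun l (hl : 0 ≤ l) => (isVariational_kDown (lam := l) hQ hα hαβ hβ hl).mem
  have hT0 : Tendsto T (𝓝[>] 0) (𝓝 (μ * μF + σ * σF * c₀)) := by
    refine ((hc₀.const_mul (σ * σF)).const_add (μ * μF)).congr' ?_
    filter_upwards [self_mem_nhdsWithin] with l hl
    rw [hT]
    simp only
    rw [inner_rescaled_eq_corr hQ (hk l (le_of_lt hl)).2.2 (hstd ▸ hσF_pos.ne'), hstd,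
      ← inner_oneVec hQ, hq1]
  have ht0 : μ * μF + σ * σF * c₀ < t := by rw [ht]; nlinarith
  have htσ : t < μ * inner ℝ oneVec q + σ * ‖centered oneVec q‖ := by
    rw [ht, hq1, hq3]; nlinarith
  have hWT : ∀ l, 0 < l →
      (W2 F (lawOf (hDown F μ σ α β l)) = ENNReal.ofReal (√ε) ↔ T l = t) := by
    intro l hl
    have hkl := hk l hl.le
    have hmono := monotoneOn_hDown (μ := μ) hσ hkl
    have hhm := memLp_hDown (μ := μ) (σ := σ) hkl.2.2
    have := isProbabilityMeasure_lawOf hmono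
    rw [W2_eq_inner hQ hhm (fun u hu => quantile_lawOf hmono (continuousWithinAt_hDown hkl) hu),
      ← integral_sub_sq hQ hhm, ofReal_sqrt_eq_iff (integral_nonneg fun _ => sq_nonneg _) hε,
      integral_sub_sq hQ hhm, ← rescaled_projVec hkl.2.2, hq2,
      inner_self_eq_of_std (inner_e_rescaled norm_oneVec _)
        (norm_centered_rescaled norm_oneVec hσ (fam.ne l hl)), hT, ht]
    simp only
    constructor <;> intro h <;> linarith
  -- Two solutions would make `T` equal to `t` on all of `(0, l₁)`, whereas its limit at `0` is
  -- strictly below `t`.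
  have huniq : ∀ l₁ l₂, 0 < l₁ → l₁ < l₂ → T l₁ = t → T l₂ ≠ t := by
    intro l₁ l₂ hl₁ hl h1 h2
    have heq := fam.rescaled_eq norm_oneVec hσ hl₁ (hl₁.trans hl) (h1.trans h2.symm)
    have hev : ∀ᶠ l in 𝓝[>] (0 : ℝ), T l = t := by
      filter_upwards [self_mem_nhdsWithin, nhdsWithin_le_nhds (Iio_mem_nhds hl₁)] with l h3 h4
      rw [← h1, hT]
      simp only
      rw [rescaled_projVec_eq hQ hα hαβ hβ hlam hσ hl₁ hl heq h3 (le_of_lt h4)]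
    exact ht0.ne (tendsto_nhds_unique hT0 (tendsto_const_nhds.congr' (hev.mono fun _ h => h.symm)))
  obtain ⟨l, hl, hlt⟩ := fam.exists_eq norm_oneVec hqc hT0 ht0 htσ
  have hW := (hWT l hl).2 hlt
  have hkl := hk l hl.le
  refine ⟨l, ⟨hl, hW, fun l' hl' hW' => ?_⟩, ⟨_, bestCase_eq_singleton hQ hα hαβ hβ hne hσ hε hl hW,
    fun u hu => quantile_lawOf (monotoneOn_hDown hσ hkl) (continuousWithinAt_hDown hkl) hu⟩, ?_,
    exists_isBlock (hQ.integrable one_le_two) hα hαβ hβ hl, fun z₀ z₁ c hb =>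
      ⟨(hb.bounds hα hαβ hβ hl.le).kDown_eq hQ hα hαβ hβ hl.le,
        fun hc => hb.blockEquations hα hαβ hβ hc⟩⟩
  · rcases lt_trichotomy l' l with h | h | h
    · exact absurd hlt (huniq l' l hl' h ((hWT l' hl').1 hW'))
    · exact h
    · exact absurd ((hWT l' hl').1 hW') (huniq l l' hl h hlt)
  · exact (isVariational_kDown hQ hα hαβ hβ hl.le).isAntitonicProjection (memLp_tilted hQ)
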